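/- **Setting (Prism).** Let $m\ge 1$, $\alpha>\tfrac12$, $\beta\ge 0$, $\Delta>0$, $0<\delta<\tfrac{40}{81}$, put $$g=e^{-\alpha\Delta},\qquad \eta=\delta^2g^2\alpha,\qquad \mu=\frac{9e^{\frac{2}{27}\eta}}{\bigl(1-e^{-\frac1{27}\eta}\bigr)^2},$$ and assume $(1-\tfrac{81}{40}\delta)g^2\alpha>\beta$. *Blocks.* For each $j\in\{0,\dots,m\}$ there are $j$-blocks numbered $0,1,2,\dots$ in order of mining time, finitely many in bounded time; $j$-block $0$ is an honest genesis block mined at time $0$. Every other $j$-block has a parent $j$-block mined strictly earlier; a block and its ancestors form a $j$-blockchain, whose height is its number of non-genesis blocks. $0$-blocks are proposer blocks, the others voter blocks. Blocks contain transactions and reference links to blocks mined strictly earlier. Each block is published at some time not before it is mined, or never; a block counts as published only once its parent and all blocks it references are published, and the transactions in it are then published too. A published block reaches every miner within $\Delta$. A $j$-blockchain (identified with its last block) is *$t$-credible* if it is published by time $t$ and is at least as high as every $j$-blockchain published by time $t-\Delta$. Honest non-genesis blocks mined at time $T$ extend a $T$-credible blockchain, and honest blocks are published when mined. A block published by time $T-\Delta$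 is observable from a block published at $T$, a block published at or after $T$ is not, and one published in between may or may not be. *Voting.* A voter block may vote on a height by a reference link to one proposer block of that height. An honest voter block mined at time $T$ votes on every height $h\ge1$ not voted on by its ancestors such that some proposer block of height $h$ is published by time $T-\Delta$; its votes go only to heights not voted on by its ancestors, and always to the first observed proposer block of that height. For each height only the first vote along a voter blockchain counts. An honest proposer block references every block observable from it to which no block observable from it has a reference link. *Ledger.* A *$t$-credible leader sequence* is a sequence $(0,b_1,\dots,b_n)$, with $n$ at least the height of every proposer blockchain published by time $t-\Delta$, for which there is a choice of one $t$-credible $j$-blockchain for each $j\in\{1,\dots,m\}$ such that, for each $\ell\le n$, $b_\ell$ is a proposer block of height $\ell$ published by time $t$ with the most votes from these $m$ voter blockchains among all such blocks, ties being resolved by a fixed rule that selects one block from the set of tied blocks. The epoch of $b_\ell$ consists of the blocks reachable from $b_\ell$ by one or more reference links that belong to no earlier epoch; it is sorted topologically (referenced blocks first) by a fixed rule. The transactions of epochs $1,\dots,n$ are listed in this order, and the *ledger* keeps a transaction from this list unless it equals, or conflicts with, one kept before. Two transactions *conflict* if they spend a common output. A transaction is *credible until $t$* if it is published by time $t$ and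 conflicts with no other transaction published by time $t$. It is *permanent after $t$* if it is on the ledger of every $u$-credible leader sequence for every $u\ge t$. *Randomness.* For a fixed adversarial strategy (which governs everything not prescribed above, including the network), the honest non-genesis $j$-blocks, $j=0,\dots,m$, are mined according to independent homogeneous Poisson processes of rate $\alpha$, and the number $Z^j_{s,t}$ of adversarial $j$-blocks mined during $(s,t]$ satisfies $$P(Z^j_{s,t}\le a)\ \ge\ e^{-\beta(t-s)}\sum_{i=0}^{a}\frac{(\beta(t-s))^i}{i!}\qquad(0\le s<t,\ a\in\mathbb{Z}_{\ge0}).$$ **Statement.** Suppose $0<\varepsilon<(m+1)\mu e^{-3(1+\Delta)\delta g^2\alpha}$ and let $$k=\left\lceil\frac{54\alpha}{\eta}\log\frac{(m+1)\mu}{\varepsilon}+4\alpha\Delta\right\rceil,\qquad t=r+\frac{2(k+1)}{(1-\frac{41}{40}\delta)^2(1-g)^2g^2\alpha}+\Delta$$ with $r\in\mathbb{R}$. Then there is an event of probability at least $1-\varepsilon$ on which every transaction that is credible until $t$ and is contained in a block (of any type) published by time $r$ is permanent after $t$. -/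

import Mathlib

open MeasureTheory ProbabilityTheory Filter

namespace Prism

/-- A block of the Prism protocol with block types `0, …, m`: the pair `(j, k)` is the `j`-block
number `k`.  Type `0` consists of the proposer blocks, the types `1, …, m` of the voter blocks,
and `(j, 0)` is the genesis `j`-block. -/
abbrev Block (m : ℕ) : Type := Fin (m + 1) × ℕ

/-- The complete record of one outcome of a Prism system, from time `0` to eternity.
Voter types are indexed by `i : Fin m`, the type being `i.succ`. -/
structure History (m : ℕ) (Tx : Type*) where
  /-- the blocks mined by honest miners -/
  honest : Block m → Prop
  /-- the time at which a block is mined -/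
  mined : Block m → ℝ
  /-- the time at which a block is published, `⊤` if this never happens -/
  published : Block m → WithTop ℝ
  /-- `parent j k` is the number of the parent of `j`-block `k` -/
  parent : Fin (m + 1) → ℕ → ℕ
  /-- `refs x y`: block `x` contains a reference link to block `y` -/
  refs : Block m → Block m → Prop
  /-- `vote i k h` is the proposer block for which voter block `(i.succ, k)` votes on height `h`,
  `none` if it does not vote on that height -/
  vote : Fin m → ℕ → ℕ → Option ℕ
  /-- `received x y` is the time at which block `y` reaches the miner of block `x` -/
  received : Block m → Block m → WithTop ℝ
  /-- the transactions recorded in a block, in their order -/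
  txs : Block m → List Tx
  /-- the time at which a transaction is published, `⊤` if this never happens -/
  txPublished : Tx → WithTop ℝ
  /-- the rule that selects the winner among proposer blocks with equally many votes -/
  tieBreak : Set ℕ → ℕ
  /-- the rule that puts the blocks of an epoch into an order -/
  sortBlocks : Set (Block m) → List (Block m)

namespace History

variable {m : ℕ} {Tx : Type*} (H : History m Tx)

/-- The blocks of `j`-blockchain `k`: block `k` and its ancestors. -/
def chain (j : Fin (m + 1)) (k : ℕ) : Set ℕ := {a | ∃ n : ℕ, (H.parent j)^[n] k = a}

/-- The height of `j`-block `k`: the number of non-genesis blocks in `j`-blockchain `k`. -/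
noncomputable def height (j : Fin (m + 1)) (k : ℕ) : ℕ := sInf {n : ℕ | (H.parent j)^[n] k = 0}

/-- `j`-blockchain `b` is `t`-credible. -/
def Credible (Δ t : ℝ) (j : Fin (m + 1)) (b : ℕ) : Prop :=
  H.published (j, b) ≤ (t : WithTop ℝ) ∧
    ∀ k : ℕ, H.published (j, k) ≤ ((t - Δ : ℝ) : WithTop ℝ) → H.height j k ≤ H.height j b

/-- Block `y` is observable from block `x`. -/
def Observable (x y : Block m) : Prop :=
  H.received x y ≤ H.published x ∧ H.published y < H.published x

/-- Some ancestor of voter block `(i.succ, k)`, other than the block itself, votes on height `h`. -/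
def AncestorVotes (i : Fin m) (k h : ℕ) : Prop :=
  ∃ a ∈ H.chain i.succ k, a ≠ k ∧ H.vote i a h ≠ none

/-- The history obeys the rules of mining and publication, of the network with delay bound `Δ`,
and of the Prism protocol.  Adversarial blocks are bound only by those rules that do not mention
`honest`. -/
structure Follows (Δ : ℝ) : Prop where
  /- mining -/
  honest_genesis : ∀ j, H.honest (j, 0)
  mined_genesis : ∀ j, H.mined (j, 0) = 0
  mined_mono : ∀ j, Monotone fun k => H.mined (j, k)
  mined_tendsto : ∀ j, Tendsto (fun k => H.mined (j, k)) atTop atTop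
  parent_genesis : ∀ j, H.parent j 0 = 0
  mined_parent_lt : ∀ j k, k ≠ 0 → H.mined (j, H.parent j k) < H.mined (j, k)
  refs_mined_lt : ∀ x y, H.refs x y → H.mined y < H.mined x
  /- publication: a block counts as published once everything it links to is published too -/
  mined_le_published : ∀ x, (H.mined x : WithTop ℝ) ≤ H.published x
  published_parent_le : ∀ j k, H.published (j, H.parent j k) ≤ H.published (j, k)
  published_refs_le : ∀ x y, H.refs x y → H.published y ≤ H.published x
  published_tx_le : ∀ x, ∀ tx ∈ H.txs x, H.txPublished tx ≤ H.published x
  /- network delays -/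
  published_le_received : ∀ x y, H.published y ≤ H.received x y
  received_le : ∀ x y, H.received x y ≤ H.published y + (Δ : WithTop ℝ)
  /- honest blocks extend credible blockchains and are published at once -/
  honest_published : ∀ x, H.honest x → H.published x = (H.mined x : WithTop ℝ)
  honest_parent : ∀ j k, H.honest (j, k) → k ≠ 0 →
    H.Credible Δ (H.mined (j, k)) j (H.parent j k)
  /- voting -/
  vote_height : ∀ i k h p, H.vote i k h = some p → H.height 0 p = h
  vote_refs : ∀ i k h p, H.vote i k h = some p → H.refs (i.succ, k) (0, p)
  /- an honest voter block votes on every height, not yet voted on by its ancestors, of which some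
  proposer block was published at least `Δ` before -/
  honest_votes : ∀ (i : Fin m) (k h : ℕ), H.honest (i.succ, k) → 1 ≤ h →
    (∃ p, H.height 0 p = h ∧
      H.published (0, p) ≤ ((H.mined (i.succ, k) - Δ : ℝ) : WithTop ℝ)) →
    ¬ H.AncestorVotes i k h → H.vote i k h ≠ none
  /- an honest voter block votes only on heights not yet voted on by its ancestors, and for the
  first observed proposer block of that height -/
  honest_vote_new : ∀ (i : Fin m) (k h p : ℕ), H.honest (i.succ, k) → H.vote i k h = some p →
    ¬ H.AncestorVotes i k h
  honest_vote_first : ∀ (i : Fin m) (k h p : ℕ), H.honest (i.succ, k) → H.vote i k h = some p →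
    H.Observable (i.succ, k) (0, p) ∧
      ∀ q, H.height 0 q = h → H.Observable (i.succ, k) (0, q) →
        H.received (i.succ, k) (0, p) ≤ H.received (i.succ, k) (0, q)
  /- an honest proposer block points to every observable block to which no observable block points -/
  honest_refs : ∀ (k : ℕ) (y : Block m), H.honest (0, k) → H.Observable (0, k) y →
    (∀ z, H.Observable (0, k) z → ¬ H.refs z y) → H.refs (0, k) y
  /- the rules for breaking ties and for topological sorting -/
  tieBreak_mem : ∀ S : Set ℕ, S.Nonempty → H.tieBreak S ∈ S
  sort_nodup : ∀ S : Set (Block m), S.Finite → (H.sortBlocks S).Nodup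
  mem_sort : ∀ S : Set (Block m), S.Finite → ∀ x, x ∈ H.sortBlocks S ↔ x ∈ S
  sort_topological : ∀ S : Set (Block m), S.Finite →
    (H.sortBlocks S).Pairwise fun x y => ¬ H.refs x y

/-- The vote of voter blockchain `(i.succ, k)` on height `h` goes to proposer block `p`: only the
first vote on that height along the blockchain counts. -/
def ChainVotes (i : Fin m) (k h p : ℕ) : Prop :=
  ∃ a ∈ H.chain i.succ k, H.vote i a h = some p ∧ ¬ H.AncestorVotes i a h

/-- The number of votes which proposer block `p` receives on height `h` from the collection `c` of
voter blockchains (one of each voter type). -/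
noncomputable def voteCount (c : Fin m → ℕ) (h p : ℕ) : ℕ :=
  {i : Fin m | H.ChainVotes i (c i) h p}.ncard

/-- The proposer blocks of height `h` published by time `t`. -/
def candidates (t : ℝ) (h : ℕ) : Set ℕ :=
  {p | H.height 0 p = h ∧ H.published (0, p) ≤ (t : WithTop ℝ)}

/-- The candidates of height `h` at time `t` with the most votes from the collection `c`. -/
def mostVoted (t : ℝ) (c : Fin m → ℕ) (h : ℕ) : Set ℕ :=
  {p | p ∈ H.candidates t h ∧ ∀ q ∈ H.candidates t h, H.voteCount c h q ≤ H.voteCount c h p}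

/-- `(b 0, b 1, …, b n)` is a `t`-credible leader sequence; the values of `b` beyond `n` are
irrelevant. -/
def CredibleLeaderSeq (Δ t : ℝ) (n : ℕ) (b : ℕ → ℕ) : Prop :=
  (∀ k, H.published (0, k) ≤ ((t - Δ : ℝ) : WithTop ℝ) → H.height 0 k ≤ n) ∧
  b 0 = 0 ∧
  ∃ c : Fin m → ℕ, (∀ i, H.Credible Δ t i.succ (c i)) ∧
    ∀ h, 1 ≤ h → h ≤ n → (H.mostVoted t c h).Nonempty ∧ b h = H.tieBreak (H.mostVoted t c h)

/-- Block `x` reaches block `y` by a sequence of reference links. -/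
def Reaches (x y : Block m) : Prop := Relation.TransGen H.refs x y

/-- The epoch of the leader block `b h`: the blocks reachable from it that do not belong to the
epoch of an earlier leader block. -/
def epoch (b : ℕ → ℕ) (h : ℕ) : Set (Block m) :=
  {x | H.Reaches (0, b h) x ∧ ∀ i, 1 ≤ i → i < h → ¬ H.Reaches (0, b i) x}

/-- All transactions recorded in the epochs of the leader blocks `b 1, …, b n`, epoch by epoch. -/
def rawLedger (n : ℕ) (b : ℕ → ℕ) : List Tx :=
  (List.range n).flatMap fun i => (H.sortBlocks (H.epoch b (i + 1))).flatMap H.txs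

end History

section Transactions

variable {Tx Out : Type*} (spends : Tx → Set Out)

/-- Two transactions conflict if there is an output which both of them spend. -/
def Conflict (tx tx' : Tx) : Prop := (spends tx ∩ spends tx').Nonempty

open Classical in
/-- Goes through a list of transactions and keeps each one unless it already was kept before or
conflicts with one kept before. -/
noncomputable def sanitize (l : List Tx) : List Tx :=
  l.foldl (fun kept tx =>
    if tx ∈ kept ∨ ∃ tx' ∈ kept, Conflict spends tx' tx then kept else kept ++ [tx]) []

variable {m : ℕ} (H : History m Tx)

/-- The transaction ledger of the leader sequence `(b 0, …, b n)`. -/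
noncomputable def ledger (n : ℕ) (b : ℕ → ℕ) : List Tx := sanitize spends (H.rawLedger n b)

/-- The transaction is credible until time `t`. -/
def CredibleUntil (t : ℝ) (tx : Tx) : Prop :=
  H.txPublished tx ≤ (t : WithTop ℝ) ∧
    ∀ tx', tx' ≠ tx → H.txPublished tx' ≤ (t : WithTop ℝ) → ¬ Conflict spends tx tx'

/-- The transaction is permanent after time `t`. -/
def PermanentAfter (Δ t : ℝ) (tx : Tx) : Prop :=
  ∀ r : ℝ, t ≤ r → ∀ (n : ℕ) (b : ℕ → ℕ), H.CredibleLeaderSeq Δ r n b → tx ∈ ledger spends H n b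

end Transactions

section Randomness

variable {m : ℕ} {Tx : Type*}

/-- The time at which the `i`-th honest non-genesis `j`-block is mined (`0`, the time of the
genesis block, for `i = 0`). -/
noncomputable def honestTime (H : History m Tx) (j : Fin (m + 1)) (i : ℕ) : ℝ :=
  H.mined (j, Nat.nth (fun k => H.honest (j, k)) i)

/-- The number of adversarial `j`-blocks mined during `(s, t]`. -/
noncomputable def adversarialCount (H : History m Tx) (j : Fin (m + 1)) (s t : ℝ) : ℕ :=
  {k : ℕ | ¬ H.honest (j, k) ∧ s < H.mined (j, k) ∧ H.mined (j, k) ≤ t}.ncard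

/-- A random history of Prism under a fixed strategy of the adversary and the network, with delay
bound `Δ`.  For every `j` the honest `j`-blocks form a homogeneous Poisson process of rate `α`
(independent exponential inter-arrival times), these `m + 1` processes are independent, and the
number of adversarial `j`-blocks mined during `(s, t]` is stochastically dominated by the Poisson
distribution with parameter `β (t - s)`. -/
structure IsPrismSystem {Ω : Type*} [MeasurableSpace Ω] (P : Measure Ω) (α β Δ : ℝ)
    (H : Ω → History m Tx) : Prop where
  follows : ∀ ω, (H ω).Follows Δ
  measurable_gap : ∀ (j : Fin (m + 1)) (i : ℕ),
    Measurable fun ω => honestTime (H ω) j (i + 1) - honestTime (H ω) j i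
  law_gap : ∀ (j : Fin (m + 1)) (i : ℕ),
    HasLaw (fun ω => honestTime (H ω) j (i + 1) - honestTime (H ω) j i) (expMeasure α) P
  indep_gap : iIndepFun (fun (p : Fin (m + 1) × ℕ) ω =>
    honestTime (H ω) p.1 (p.2 + 1) - honestTime (H ω) p.1 p.2) P
  measurable_adversarial : ∀ (j : Fin (m + 1)) (s t : ℝ),
    Measurable fun ω => adversarialCount (H ω) j s t
  adversarial_le : ∀ (j : Fin (m + 1)) (s t : ℝ), 0 ≤ s → s < t → ∀ a : ℕ,
    Real.exp (-(β * (t - s))) * ∑ i ∈ Finset.range (a + 1), (β * (t - s)) ^ i / (i.factorial : ℝ)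
      ≤ P.real {ω | adversarialCount (H ω) j s t ≤ a}

end Randomness

/-- `g = e^{-αΔ}` -/
noncomputable def g (α Δ : ℝ) : ℝ := Real.exp (-(α * Δ))

/-- `η = δ² g² α` -/
noncomputable def eta (α Δ δ : ℝ) : ℝ := δ ^ 2 * g α Δ ^ 2 * α

/-- `μ = 9 e^{2η/27} / (1 - e^{-η/27})²` -/
noncomputable def mu (α Δ δ : ℝ) : ℝ :=
  9 * Real.exp (2 / 27 * eta α Δ δ) / (1 - Real.exp (-(1 / 27 * eta α Δ δ))) ^ 2

end Prism

/-! Two races decide the outcome. An honest block mined more than `Δ` after the previous honest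
block of its type is higher than all earlier honest ones; if the next honest block also takes more
than `Δ`, it is the only honest block of its height. Hence a block that matches one of the first
kind before any later honest block does, or that stands in a chain in place of one of the second
kind, is adversarial, and distinct heights need distinct adversarial blocks. Blocks of the first
kind have rate `g α`, those of the second `g² α`, and `β` is smaller than both by a margin governed
by `δ`.

Put `p = t - 2Δ - L`. If the proposer race is won from every starting time up to `r + Δ`, then
`exists_uncontested` gives an honest proposer block `b` mined in `(r + Δ, p]` such that every block
of its height `h` mined by `t` is honest and no earlier than `b`. If the voter races are won from
every start up to `p + Δ` and for every end from `t` on, then `exists_honest_mem_chain` puts an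
honest voter block mined in `(p + Δ, t]` on each credible voter chain from time `t` on. That block
has seen the chain of `b`, so the counted votes on heights up to `h` are all cast by time `t`.

`permanentAfter_of_uncontested` draws the conclusion. The leaders need not be the same in all leader
sequences: any leader of height `h` is published by `t`, so it is honest and late enough to reach
all blocks published by `r`. Everything in epochs `1, …, h` is published by `t`, so nothing listed
there conflicts with a transaction credible until `t`.

For a single window, `window_race` bounds the failure probability by Chernoff estimates.
`exists_event` rounds the ends of the windows to an integer grid and sums a geometric series in each
direction. The factor `μ` absorbs these series, and the prescribed waiting time leaves room for `L =
300 log((m + 1) μ / ε) / η`. -/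

namespace Prism

/-! ### Exponential waiting times and their Chernoff bound -/

section Exponential

variable {Ω : Type*} [MeasurableSpace Ω] {P : Measure Ω} {α : ℝ}

/-- The tail of the exponential distribution. -/
lemma expMeasure_Ioi (hα : 0 < α) {x : ℝ} (hx : 0 ≤ x) :
    expMeasure α (Set.Ioi x) = ENNReal.ofReal (Real.exp (-(α * x))) := by
  have := isProbabilityMeasure_expMeasure hα
  have h := cdf_expMeasure_eq hα x
  rw [if_pos hx, cdf_eq_real] at h
  rw [← Set.compl_Iic, ← ofReal_measureReal, probReal_compl_eq_one_sub measurableSet_Iic, h]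
  congr 1; ring

lemma expMeasure_Ioi_zero (hα : 0 < α) : expMeasure α (Set.Ioi 0) = 1 := by
  simp [expMeasure_Ioi hα le_rfl]

/-- Tilting the density of rate `α` by `exp (θ x)` gives the density of rate `α - θ` up to the
factor `α / (α - θ)`. -/
lemma lintegral_exp_expMeasure (hα : 0 < α) {θ : ℝ} (hθ : θ < α) :
    ∫⁻ x, ENNReal.ofReal (Real.exp (θ * x)) ∂(expMeasure α) = ENNReal.ofReal (α / (α - θ)) := by
  have hθ' : 0 < α - θ := by linarith
  have hm : Measurable (exponentialPDF α) :=
    (measurable_exponentialPDFReal α).ennreal_ofReal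
  have hm' : Measurable (exponentialPDF (α - θ)) :=
    (measurable_exponentialPDFReal (α - θ)).ennreal_ofReal
  have : expMeasure α = volume.withDensity (exponentialPDF α) := rfl
  rw [this, lintegral_withDensity_eq_lintegral_mul _ hm (by fun_prop)]
  have h2 : ∀ x, (exponentialPDF α * fun x => ENNReal.ofReal (Real.exp (θ * x))) x
      = ENNReal.ofReal (α / (α - θ)) * exponentialPDF (α - θ) x := by
    intro x
    simp only [Pi.mul_apply]
    rcases lt_or_ge x 0 with h | h
    · simp [exponentialPDF_of_neg h]
    · rw [exponentialPDF_of_nonneg h, exponentialPDF_of_nonneg h, ← ENNReal.ofReal_mul (by positivity),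
        ← ENNReal.ofReal_mul (by positivity)]
      congr 1
      rw [mul_assoc, ← Real.exp_add]
      field_simp
      ring_nf
  simp_rw [h2]
  rw [lintegral_const_mul _ hm', lintegral_exponentialPDF_eq_one hθ', mul_one]

variable {X : Ω → ℝ}

lemma HasLaw.lintegral_exp (hα : 0 < α) (hX : HasLaw X (expMeasure α) P)
    {θ : ℝ} (hθ : θ < α) :
    ∫⁻ ω, ENNReal.ofReal (Real.exp (θ * X ω)) ∂P = ENNReal.ofReal (α / (α - θ)) := by
  rw [← lintegral_exp_expMeasure hα hθ, ← hX.map_eq, lintegral_map' (by fun_prop) hX.aemeasurable]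

lemma HasLaw.integrable_exp (hα : 0 < α) (hX : HasLaw X (expMeasure α) P)
    {θ : ℝ} (hθ : θ < α) : Integrable (fun ω => Real.exp (θ * X ω)) P := by
  have h := HasLaw.lintegral_exp hα hX hθ
  have := hX.aemeasurable
  refine (lintegral_ofReal_ne_top_iff_integrable ?_ ?_).1 ?_
  · exact AEMeasurable.aestronglyMeasurable (by fun_prop)
  · exact ae_of_all _ fun ω => (Real.exp_pos _).le
  · rw [h]; exact ENNReal.ofReal_ne_top

lemma HasLaw.mgf_exp (hα : 0 < α) (hX : HasLaw X (expMeasure α) P)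
    {θ : ℝ} (hθ : θ < α) : mgf X P θ = α / (α - θ) := by
  have := hX.aemeasurable
  rw [mgf, integral_eq_lintegral_of_nonneg_ae (ae_of_all _ fun ω => (Real.exp_pos _).le)
    (AEMeasurable.aestronglyMeasurable (by fun_prop)), HasLaw.lintegral_exp hα hX hθ,
    ENNReal.toReal_ofReal]
  have : 0 < α - θ := by linarith
  positivity

lemma HasLaw.ae_pos (hα : 0 < α) (hX : HasLaw X (expMeasure α) P) :
    ∀ᵐ ω ∂P, 0 < X ω := by
  have := isProbabilityMeasure_expMeasure hα
  have h1 : ∀ᵐ x ∂(expMeasure α), 0 < x := by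
    rw [ae_iff]
    have : {a : ℝ | ¬ 0 < a} = (Set.Ioi 0)ᶜ := by ext; simp
    rw [this, prob_compl_eq_zero_iff measurableSet_Ioi, expMeasure_Ioi_zero hα]
  rw [← hX.map_eq] at h1
  exact ae_of_ae_map hX.aemeasurable h1

variable [IsProbabilityMeasure P] {G : ℕ → Ω → ℝ}

/-- Chernoff bound for the upper tail of a sum of independent exponential variables. -/
lemma exp_sum_tail (hα : 0 < α) (hm : ∀ i, Measurable (G i)) (hi : iIndepFun G P)
    (hl : ∀ i, HasLaw (G i) (expMeasure α) P) (I : Finset ℕ) {θ : ℝ} (h0 : 0 ≤ θ) (hθ : θ < α)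
    (y : ℝ) :
    P.real {ω | y ≤ ∑ i ∈ I, G i ω} ≤ Real.exp (-θ * y) * (α / (α - θ)) ^ I.card := by
  have h1 := measure_ge_le_exp_mul_mgf (μ := P) (X := ∑ i ∈ I, G i) (t := θ) y h0 ?_
  · rw [hi.mgf_sum hm] at h1
    simp only [HasLaw.mgf_exp hα (hl _) hθ, Finset.prod_const, Finset.sum_apply] at h1
    exact h1
  · exact hi.integrable_exp_mul_sum hm fun i _ => HasLaw.integrable_exp hα (hl i) hθ

end Exponential

/-! ### Independence of functions of disjoint blocks of variables -/

section Independence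

variable {Ω : Type*} [MeasurableSpace Ω] {P : Measure Ω} {G : ℕ → Ω → ℝ}

/-- Functions of the variables with indices in disjoint finite sets are independent. -/
lemma indepFun_of_dependsOn {β γ : Type*} [MeasurableSpace β] [MeasurableSpace γ]
    (hm : ∀ i, Measurable (G i)) (hi : iIndepFun G P)
    {S T : Finset ℕ} (hST : Disjoint S T) {A : (ℕ → ℝ) → β} {B : (ℕ → ℝ) → γ}
    (hA : Measurable A) (hB : Measurable B)
    (hA' : ∀ x y : ℕ → ℝ, (∀ i ∈ S, x i = y i) → A x = A y)
    (hB' : ∀ x y : ℕ → ℝ, (∀ i ∈ T, x i = y i) → B x = B y) :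
    IndepFun (fun ω => A fun i => G i ω) (fun ω => B fun i => G i ω) P := by
  classical
  have h := hi.indepFun_finset S T hST hm
  -- Extension by zero: since `A` and `B` ignore the other coordinates, the default value is
  -- irrelevant.
  let e : (U : Finset ℕ) → (U → ℝ) → (ℕ → ℝ) := fun U f i => if h : i ∈ U then f ⟨i, h⟩ else 0
  have he : ∀ U, Measurable (e U) := by
    intro U
    refine measurable_pi_lambda _ fun i => ?_
    by_cases h : i ∈ U
    · simp only [e, h, dite_true]; fun_prop
    · simp only [e, h, dite_false]; fun_prop
  have h2 := h.comp (hA.comp (he S)) (hB.comp (he T))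
  convert h2 using 1
  · funext ω
    exact hA' _ _ fun i hi => by simp [e, hi]
  · funext ω
    exact hB' _ _ fun i hi => by simp [e, hi]

end Independence

/-! ### Chernoff bounds for counts of pairs and for Poisson variables -/

section Bernoulli

variable {Ω : Type*} [MeasurableSpace Ω] {P : Measure Ω} [IsProbabilityMeasure P] {G : ℕ → Ω → ℝ}

lemma mgf_indicator {E : Set Ω} (hE : MeasurableSet E) (t : ℝ) :
    mgf (E.indicator fun _ => (1 : ℝ)) P t = 1 + P.real E * (Real.exp t - 1) := by
  have : (fun ω => Real.exp (t * E.indicator (fun _ => (1 : ℝ)) ω))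
      = fun ω => 1 + E.indicator (fun _ => Real.exp t - 1) ω := by
    funext ω
    by_cases h : ω ∈ E <;> simp [h]
  rw [mgf, this, integral_add (integrable_const _) ((integrable_const _).indicator hE),
    integral_indicator hE]
  simp

/-- Chernoff bound for the number of indices `i < n` for which the pair of consecutive variables
numbered `a + 2 * i` and `a + 2 * i + 1` lies in a given set. -/
lemma pair_sum_tail (hm : ∀ i, Measurable (G i)) (hi : iIndepFun G P)
    {D : Set (ℝ × ℝ)} (hD : MeasurableSet D) {p : ℝ} (a n : ℕ)
    (hp : ∀ i, P.real {ω | (G i ω, G (i + 1) ω) ∈ D} = p) {x : ℝ} (hx : 0 ≤ x) (hx' : x ≤ 1) :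
    P.real {ω | ∑ i ∈ Finset.range n,
        D.indicator (fun _ => (1 : ℝ)) (G (a + 2 * i) ω, G (a + 2 * i + 1) ω) ≤ (1 - x) * (p * n)}
      ≤ Real.exp (-(x ^ 2 / 4 * (p * n))) := by
  let F : ℕ → (ℕ → ℝ) → ℝ := fun n y => ∑ i ∈ Finset.range n,
        D.indicator (fun _ => (1 : ℝ)) (y (a + 2 * i), y (a + 2 * i + 1))
  have hind : Measurable (D.indicator (fun _ => (1 : ℝ))) := measurable_const.indicator hD
  have hF : ∀ n, Measurable (F n) := by
    intro n
    refine Finset.measurable_sum _ fun i _ => ?_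
    exact hind.comp (by fun_prop)
  have hp0 : 0 ≤ p := by rw [← hp 0]; exact measureReal_nonneg
  have hint : ∀ (n : ℕ) (t : ℝ), Integrable (fun ω => Real.exp (t * F n fun i => G i ω)) P := by
    intro n t
    have hmeas : Measurable (fun ω => F n fun i => G i ω) := (hF n).comp (measurable_pi_lambda _ hm)
    refine Integrable.of_bound (C := Real.exp (|t| * n)) (Real.measurable_exp.comp (hmeas.const_mul t)).aestronglyMeasurable (ae_of_all _ fun ω => ?_)
    rw [Real.norm_eq_abs, Real.abs_exp]
    refine Real.exp_le_exp.2 ?_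
    refine (le_abs_self _).trans ?_
    rw [abs_mul]
    gcongr
    have h0 : 0 ≤ F n fun i => G i ω :=
      Finset.sum_nonneg fun i _ => Set.indicator_nonneg (fun _ _ => zero_le_one) _
    rw [abs_of_nonneg h0]
    calc F n (fun i => G i ω) ≤ ∑ i ∈ Finset.range n, (1 : ℝ) :=
          Finset.sum_le_sum fun i _ => Set.indicator_le_self' (fun _ _ => zero_le_one) _
      _ = n := by simp
  have hmgf : ∀ (n : ℕ) (t : ℝ), mgf (fun ω => F n fun i => G i ω) P t
      = (1 + p * (Real.exp t - 1)) ^ n := by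
    intro n t
    induction n with
    | zero => simp [F, mgf]
    | succ n ih =>
      let B : (ℕ → ℝ) → ℝ := fun y =>
        D.indicator (fun _ => (1 : ℝ)) (y (a + 2 * n), y (a + 2 * n + 1))
      have hB : Measurable B := hind.comp (by fun_prop)
      have hindep : IndepFun (fun ω => F n fun i => G i ω) (fun ω => B fun i => G i ω) P := by
        -- The stride 2 makes the pairs disjoint, so the earlier summands use only indices below `a
        -- + 2 * n`.
        refine indepFun_of_dependsOn hm hi (S := Finset.range (a + 2 * n))
          (T := {a + 2 * n, a + 2 * n + 1}) ?_ (hF n) hB ?_ ?_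
        · rw [Finset.disjoint_left]; intro i; simp; omega
        · intro y z h
          refine Finset.sum_congr rfl fun i hi => ?_
          rw [Finset.mem_range] at hi
          rw [h _ (by simp; omega), h _ (by simp; omega)]
        · intro y z h
          simp only [B]
          rw [h _ (by simp), h _ (by simp)]
      have hsum : (fun ω => F (n + 1) fun i => G i ω)
          = (fun ω => F n fun i => G i ω) + fun ω => B fun i => G i ω := by
        funext ω; simp [F, B, Finset.sum_range_succ]
      have hEm : MeasurableSet {ω | (G (a + 2 * n) ω, G (a + 2 * n + 1) ω) ∈ D} :=
        ((hm _).prodMk (hm _)) hD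
      have hBi : (fun ω => B fun i => G i ω)
          = Set.indicator {ω | (G (a + 2 * n) ω, G (a + 2 * n + 1) ω) ∈ D} fun _ => (1 : ℝ) := by
        funext ω; simp [B, Set.indicator]
      rw [hsum, hindep.mgf_add, ih, hBi, mgf_indicator hEm, hp, pow_succ]
      · exact (Real.measurable_exp.comp (((hF n).comp
          (measurable_pi_lambda _ hm)).const_mul t)).aestronglyMeasurable
      · exact (Real.measurable_exp.comp ((hB.comp
          (measurable_pi_lambda _ hm)).const_mul t)).aestronglyMeasurable
  -- With parameter `-x/2` and `exp (-x/2) - 1 ≤ -x/2 + x²/4`, the exponent is `p n` times `(x/2)(1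
  -- - x) - x/2 + x²/4 = -x²/4`.
  have h1 := measure_le_le_exp_mul_mgf (μ := P) (X := fun ω => F n fun i => G i ω) (t := -(x / 2))
    ((1 - x) * (p * n)) (by linarith) (hint n _)
  refine h1.trans ?_
  rw [hmgf]
  have h2 : Real.exp (-(x / 2)) - 1 ≤ -(x / 2) + (x / 2) ^ 2 := by
    have h := (abs_le.1 (Real.abs_exp_sub_one_sub_id_le (x := -(x / 2)) (by
      rw [abs_le]; constructor <;> linarith))).2
    nlinarith
  have h3 : 1 + p * (Real.exp (-(x / 2)) - 1) ≤ Real.exp (p * (-(x / 2) + (x / 2) ^ 2)) := by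
    have := Real.add_one_le_exp (p * (-(x / 2) + (x / 2) ^ 2))
    nlinarith [mul_le_mul_of_nonneg_left h2 hp0]
  have hp1 : p ≤ 1 := by rw [← hp 0]; exact measureReal_le_one
  have h4 : 0 ≤ 1 + p * (Real.exp (-(x / 2)) - 1) := by
    nlinarith [Real.exp_pos (-(x / 2))]
  calc _ ≤ Real.exp (- -(x / 2) * ((1 - x) * (p * n))) *
        (Real.exp (p * (-(x / 2) + (x / 2) ^ 2))) ^ n := by gcongr
    _ = _ := by
        rw [← Real.exp_nat_mul, ← Real.exp_add]
        congr 1; ring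

end Bernoulli

/-- Upper tail of the Poisson distribution. -/
lemma poisson_tail {l θ : ℝ} (hl : 0 ≤ l) (hθ : 0 ≤ θ) (a : ℕ) :
    1 - Real.exp (-l) * ∑ i ∈ Finset.range (a + 1), l ^ i / (i.factorial : ℝ)
      ≤ Real.exp (-(θ * (a + 1)) + l * (Real.exp θ - 1)) := by
  have h1 : HasSum (fun i : ℕ => l ^ i / (i.factorial : ℝ)) (Real.exp l) := by
    rw [Real.exp_eq_exp_ℝ]; exact NormedSpace.expSeries_div_hasSum_exp l
  have h2 : HasSum (fun i : ℕ => (l * Real.exp θ) ^ i / (i.factorial : ℝ))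
      (Real.exp (l * Real.exp θ)) := by
    rw [Real.exp_eq_exp_ℝ]; exact NormedSpace.expSeries_div_hasSum_exp _
  have h3 := (hasSum_nat_add_iff' (a + 1)).2 h1
  -- The Chernoff argument term by term: beyond index `a` the tilting factor `exp (θ (i - (a + 1)))`
  -- is at least 1.
  have h4 : ∀ i : ℕ, l ^ (i + (a + 1)) / ((i + (a + 1)).factorial : ℝ)
      ≤ Real.exp (-(θ * (a + 1))) *
        ((l * Real.exp θ) ^ (i + (a + 1)) / ((i + (a + 1)).factorial : ℝ)) := by
    intro i
    rw [mul_pow, ← Real.exp_nat_mul]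
    have : 1 ≤ Real.exp (-(θ * (a + 1))) * Real.exp (((i + (a + 1) : ℕ) : ℝ) * θ) := by
      rw [← Real.exp_add]
      refine Real.one_le_exp ?_
      push_cast
      have : 0 ≤ (i : ℝ) * θ := by positivity
      nlinarith
    have h5 : 0 ≤ l ^ (i + (a + 1)) / ((i + (a + 1)).factorial : ℝ) := by positivity
    calc _ = l ^ (i + (a + 1)) / ((i + (a + 1)).factorial : ℝ) * 1 := by ring
      _ ≤ l ^ (i + (a + 1)) / ((i + (a + 1)).factorial : ℝ) *
          (Real.exp (-(θ * (a + 1))) * Real.exp (((i + (a + 1) : ℕ) : ℝ) * θ)) := by gcongr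
      _ = _ := by ring
  have h6 := (hasSum_nat_add_iff' (a + 1)).2 h2
  have h7 := hasSum_le h4 h3 (h6.mul_left (Real.exp (-(θ * (a + 1)))))
  have h8 : 0 ≤ ∑ i ∈ Finset.range (a + 1), (l * Real.exp θ) ^ i / (i.factorial : ℝ) := by positivity
  have h9 : Real.exp l - ∑ i ∈ Finset.range (a + 1), l ^ i / (i.factorial : ℝ)
      ≤ Real.exp (-(θ * (a + 1))) * Real.exp (l * Real.exp θ) := by
    refine h7.trans ?_
    gcongr
    linarith
  have h10 := mul_le_mul_of_nonneg_left h9 (Real.exp_pos (-l)).le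
  rw [mul_sub, ← Real.exp_add, ← Real.exp_add, ← Real.exp_add] at h10
  rw [neg_add_cancel, Real.exp_zero] at h10
  refine h10.trans (le_of_eq ?_)
  congr 1; ring

/-! ### Renewals in a fixed time window -/

section Renewal

variable {Ω : Type*} [MeasurableSpace Ω] {P : Measure Ω} [IsProbabilityMeasure P]
  {G : ℕ → Ω → ℝ} {α : ℝ}

/-- The residual waiting time of a renewal process with exponential waiting times is memoryless. -/
lemma residual_tail (hα : 0 < α) (hm : ∀ i, Measurable (G i)) (hi : iIndepFun G P)
    (hl : ∀ i, HasLaw (G i) (expMeasure α) P) (n : ℕ) (s : ℝ) {x : ℝ} (hx : 0 ≤ x) :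
    P {ω | ∑ i ∈ Finset.range n, G i ω ≤ s ∧ s + x < ∑ i ∈ Finset.range (n + 1), G i ω}
      = ENNReal.ofReal (Real.exp (-(α * x))) *
        P {ω | ∑ i ∈ Finset.range n, G i ω ≤ s ∧ s < ∑ i ∈ Finset.range (n + 1), G i ω} := by
  have := isProbabilityMeasure_expMeasure hα
  have hS : Measurable fun ω => ∑ i ∈ Finset.range n, G i ω :=
    Finset.measurable_sum _ fun i _ => hm i
  have hind : IndepFun (fun ω => ∑ i ∈ Finset.range n, G i ω) (G n) P := by
    have := hi.indepFun_finsetSum_of_notMem hm (s := Finset.range n) (i := n) (by simp)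
    convert this using 1
    funext ω; simp
  have hmap := (indepFun_iff_map_prod_eq_prod_map_map hS.aemeasurable (hm n).aemeasurable).1 hind
  rw [(hl n).map_eq] at hmap
  have hset : ∀ z : ℝ, MeasurableSet {q : ℝ × ℝ | q.1 ≤ s ∧ s + z < q.1 + q.2} := fun z =>
    (measurableSet_le measurable_fst measurable_const).inter
      (measurableSet_lt measurable_const (measurable_fst.add measurable_snd))
  have key : ∀ z : ℝ, 0 ≤ z →
      P {ω | ∑ i ∈ Finset.range n, G i ω ≤ s ∧ s + z < ∑ i ∈ Finset.range (n + 1), G i ω}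
      = ∫⁻ y, (Set.Iic s).indicator (fun y => ENNReal.ofReal (Real.exp (-(α * (s - y))))) y *
          ENNReal.ofReal (Real.exp (-(α * z))) ∂(P.map fun ω => ∑ i ∈ Finset.range n, G i ω) := by
    intro z hz
    have h1 : {ω | ∑ i ∈ Finset.range n, G i ω ≤ s ∧ s + z < ∑ i ∈ Finset.range (n + 1), G i ω}
        = (fun ω => (∑ i ∈ Finset.range n, G i ω, G n ω)) ⁻¹'
          {q : ℝ × ℝ | q.1 ≤ s ∧ s + z < q.1 + q.2} := by
      ext ω; simp [Finset.sum_range_succ]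
    rw [h1, ← Measure.map_apply (hS.prodMk (hm n)) (hset z), hmap,
      Measure.prod_apply (hset z)]
    refine lintegral_congr fun y => ?_
    -- Given a partial sum `y ≤ s`, the tail of the next waiting time is `exp (-α (s - y)) * exp (-α
    -- z)`; the second factor does not depend on `y` and leaves the integral.
    by_cases hy : y ≤ s
    · have h2 : Prod.mk y ⁻¹' {q : ℝ × ℝ | q.1 ≤ s ∧ s + z < q.1 + q.2}
          = Set.Ioi (s + z - y) := by
        ext w
        simp only [Set.mem_preimage, Set.mem_ofPred_eq, Set.mem_Ioi, hy, true_and]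
        constructor <;> intro h <;> linarith
      rw [h2, expMeasure_Ioi hα (by linarith), Set.indicator_of_mem (by simpa using hy),
        ← ENNReal.ofReal_mul (Real.exp_pos _).le, ← Real.exp_add]
      congr 2; ring
    · have h2 : Prod.mk y ⁻¹' {q : ℝ × ℝ | q.1 ≤ s ∧ s + z < q.1 + q.2} = ∅ := by
        ext w; simp [hy]
      rw [h2, Set.indicator_of_notMem (by simpa using hy)]; simp
  have h0 := key 0 le_rfl
  simp only [add_zero, mul_zero, neg_zero, Real.exp_zero, ENNReal.ofReal_one, mul_one] at h0
  rw [key x hx, h0, mul_comm (ENNReal.ofReal _), ← lintegral_mul_const]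
  refine Measurable.indicator ?_ measurableSet_Iic
  fun_prop

/-- Lower tail of the number of renewals in a time window `(s, s + T]` for which the waiting time
before exceeds `Δ` and the waiting time after lies in `B`. -/
lemma window_tail (hα : 0 < α) (hm : ∀ i, Measurable (G i)) (hi : iIndepFun G P)
    (hl : ∀ i, HasLaw (G i) (expMeasure α) P) {s : ℝ}
    (hex : ∀ᵐ ω ∂P, ∃ n, ∑ i ∈ Finset.range n, G i ω ≤ s ∧ s < ∑ i ∈ Finset.range (n + 1), G i ω)
    {Δ : ℝ} {B : Set ℝ} (hB : MeasurableSet B) {p : ℝ}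
    (hp : ∀ i, P.real {ω | Δ < G i ω ∧ G (i + 1) ω ∈ B} = p)
    {x y θ T v : ℝ} (hx : 0 ≤ x) (hy : 0 ≤ y) (hy' : y ≤ 1) (hθ : 0 ≤ θ) (hθ' : θ < α)
    {N : ℕ} (hv : v ≤ 2 * ((1 - y) * (p * N))) :
    P {ω | ¬ ∃ F : Finset ℕ, (∀ l ∈ F, s < ∑ i ∈ Finset.range (l + 1), G i ω ∧
        ∑ i ∈ Finset.range (l + 1), G i ω ≤ s + T ∧ Δ < G l ω ∧ G (l + 1) ω ∈ B) ∧ v ≤ F.card}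
      ≤ ENNReal.ofReal (Real.exp (-(α * x)) + (Real.exp (-θ * (T - x)) * (α / (α - θ)) ^ (2 * N)
          + 2 * Real.exp (-(y ^ 2 / 4 * (p * N))))) := by
  classical
  set D : Set (ℝ × ℝ) := {z | Δ < z.1 ∧ z.2 ∈ B} with hD
  have hDm : MeasurableSet D :=
    (measurableSet_lt measurable_const measurable_fst).inter (measurable_snd hB)
  have hind : Measurable (D.indicator (fun _ => (1 : ℝ))) := measurable_const.indicator hDm
  -- the event that the renewal with number `n` is the last one before time `s`
  let E : ℕ → Set Ω := fun n =>
    {ω | ∑ i ∈ Finset.range n, G i ω ≤ s ∧ s < ∑ i ∈ Finset.range (n + 1), G i ω}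
  let R : ℕ → Set Ω := fun n =>
    {ω | ∑ i ∈ Finset.range n, G i ω ≤ s ∧ s + x < ∑ i ∈ Finset.range (n + 1), G i ω}
  -- Overlapping pairs are dependent, so they are split by parity: the pairs with offsets 1 and 2
  -- form two families, each made of disjoint pairs, which together start at each of `n + 1, …, n +
  -- 2 * N` once. Waiting time `n`, which straddles `s`, is left out because `E n` biases it.
  let C : ℕ → ℕ → Set Ω := fun n c => {ω | ∑ i ∈ Finset.range N,
        D.indicator (fun _ => (1 : ℝ)) (G (n + c + 2 * i) ω, G (n + c + 2 * i + 1) ω)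
          ≤ (1 - y) * (p * N)}
  let Q : ℕ → Set Ω := fun n =>
    {ω | T - x ≤ ∑ i ∈ Finset.Ico (n + 1) (n + 1 + 2 * N), G i ω} ∪ (C n 1 ∪ C n 2)
  have hSm : ∀ I : Finset ℕ, Measurable fun ω => ∑ i ∈ I, G i ω := fun I =>
    Finset.measurable_sum _ fun i _ => hm i
  have hEm : ∀ n, MeasurableSet (E n) := fun n =>
    (measurableSet_le (hSm _) measurable_const).inter (measurableSet_lt measurable_const (hSm _))
  have hpos : ∀ᵐ ω ∂P, ∀ i, 0 < G i ω := ae_all_iff.2 fun i => HasLaw.ae_pos hα (hl i)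
  have hmono : ∀ ω, (∀ i, 0 < G i ω) → Monotone fun n => ∑ i ∈ Finset.range n, G i ω := by
    intro ω h
    refine monotone_nat_of_le_succ fun n => ?_
    rw [Finset.sum_range_succ]
    linarith [h n]
  have hdisj : Pairwise fun i j => AEDisjoint P (E i) (E j) := by
    have aux : ∀ i j, i < j → AEDisjoint P (E i) (E j) := by
      intro i j hij
      refine measure_mono_null ?_ (ae_iff.1 hpos)
      rintro ω ⟨h1, h2⟩ h
      have := hmono ω h (Nat.succ_le_of_lt hij)
      exact absurd (h1.2.trans_le (this.trans h2.1)) (lt_irrefl _)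
    intro i j hij
    rcases lt_or_gt_of_ne hij with h | h
    · exact aux i j h
    · exact (aux j i h).symm
  have hsum : ∑' n, P (E n) ≤ 1 := by
    rw [← measure_univ (μ := P)]
    exact tsum_measure_le_measure_univ (fun n => (hEm n).nullMeasurableSet) hdisj
  -- independence of the past and the future
  have hindep : ∀ n, P (E n ∩ Q n) = P (E n) * P (Q n) := by
    intro n
    have hcoord : ∀ I : Finset ℕ, Measurable fun z : ℕ → ℝ => ∑ i ∈ I, z i := fun I => by fun_prop
    let E' : Set (ℕ → ℝ) :=
      {z | ∑ i ∈ Finset.range n, z i ≤ s ∧ s < ∑ i ∈ Finset.range (n + 1), z i}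
    let C' : ℕ → Set (ℕ → ℝ) := fun c => {z | ∑ i ∈ Finset.range N,
        D.indicator (fun _ => (1 : ℝ)) (z (n + c + 2 * i), z (n + c + 2 * i + 1))
          ≤ (1 - y) * (p * N)}
    let Q' : Set (ℕ → ℝ) :=
      {z | T - x ≤ ∑ i ∈ Finset.Ico (n + 1) (n + 1 + 2 * N), z i} ∪ (C' 1 ∪ C' 2)
    have hE' : MeasurableSet E' :=
      (measurableSet_le (hcoord _) measurable_const).inter
        (measurableSet_lt measurable_const (hcoord _))
    have hC' : ∀ c, MeasurableSet (C' c) := fun c =>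
      measurableSet_le (Finset.measurable_sum _ fun i _ => hind.comp (by fun_prop))
        measurable_const
    have hQ' : MeasurableSet Q' :=
      (measurableSet_le measurable_const (hcoord _)).union ((hC' 1).union (hC' 2))
    -- The future extends to index `n + 1 + 2 * N`, the second entry of the last pair with offset 2.
    have h := indepFun_of_dependsOn hm hi (S := Finset.range (n + 1))
      (T := Finset.Ico (n + 1) (n + 2 + 2 * N)) (A := fun z => z ∈ E') (B := fun z => z ∈ Q')
      (by rw [Finset.disjoint_left]; intro i; simp; omega)
      (measurableSet_setOfPred.1 hE') (measurableSet_setOfPred.1 hQ') ?_ ?_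
    · have h' := h.measure_inter_preimage_eq_mul {True} {True} trivial trivial
      have e1 : (fun ω => (fun i => G i ω) ∈ E') ⁻¹' {True} = E n := by ext ω; simp [E, E']
      have e2 : (fun ω => (fun i => G i ω) ∈ Q') ⁻¹' {True} = Q n := by
        ext ω; simp [Q, Q', C, C']
      rwa [e1, e2] at h'
    · intro w z h
      have h1 : ∑ i ∈ Finset.range n, w i = ∑ i ∈ Finset.range n, z i :=
        Finset.sum_congr rfl fun i hi => h i (by simp at hi ⊢; omega)
      have h2 : ∑ i ∈ Finset.range (n + 1), w i = ∑ i ∈ Finset.range (n + 1), z i :=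
        Finset.sum_congr rfl fun i hi => h i hi
      simp only [E', Set.mem_ofPred_eq, h1, h2]
    · intro w z h
      have h1 : ∑ i ∈ Finset.Ico (n + 1) (n + 1 + 2 * N), w i
          = ∑ i ∈ Finset.Ico (n + 1) (n + 1 + 2 * N), z i :=
        Finset.sum_congr rfl fun i hi => h i (by simp at hi ⊢; omega)
      have h2 : ∀ c, 1 ≤ c → c ≤ 2 → (∑ i ∈ Finset.range N,
          D.indicator (fun _ => (1 : ℝ)) (w (n + c + 2 * i), w (n + c + 2 * i + 1)))
          = ∑ i ∈ Finset.range N,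
          D.indicator (fun _ => (1 : ℝ)) (z (n + c + 2 * i), z (n + c + 2 * i + 1)) := by
        intro c hc hc'
        refine Finset.sum_congr rfl fun i hi => ?_
        rw [Finset.mem_range] at hi
        rw [h _ (by simp; omega), h _ (by simp; omega)]
      simp only [Q', C', Set.mem_union, Set.mem_ofPred_eq, h1, h2 1 le_rfl (by norm_num),
        h2 2 (by norm_num) le_rfl]
  set b : ℝ := Real.exp (-θ * (T - x)) * (α / (α - θ)) ^ (2 * N)
          + 2 * Real.exp (-(y ^ 2 / 4 * (p * N))) with hb
  have hQ : ∀ n, P (Q n) ≤ ENNReal.ofReal b := by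
    intro n
    have h1 := exp_sum_tail hα hm hi hl (Finset.Ico (n + 1) (n + 1 + 2 * N)) hθ hθ' (T - x)
    have h2 : ∀ c, P.real (C n c) ≤ Real.exp (-(y ^ 2 / 4 * (p * N))) := fun c =>
      pair_sum_tail hm hi hDm (n + c) N (fun i => hp i) hy hy'
    rw [Nat.card_Ico, Nat.add_sub_cancel_left] at h1
    rw [← ofReal_measureReal]
    refine ENNReal.ofReal_le_ofReal ?_
    calc P.real (Q n) ≤ _ + P.real (C n 1 ∪ C n 2) := measureReal_union_le _ _
      _ ≤ _ + (P.real (C n 1) + P.real (C n 2)) := by gcongr; exact measureReal_union_le _ _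
      _ ≤ b := by rw [hb]; linarith [h2 1, h2 2]
  -- the deterministic inclusion
  have hsub : ∀ᵐ ω ∂P, ω ∈ {ω | ¬ ∃ F : Finset ℕ, (∀ l ∈ F,
      s < ∑ i ∈ Finset.range (l + 1), G i ω ∧
        ∑ i ∈ Finset.range (l + 1), G i ω ≤ s + T ∧ Δ < G l ω ∧ G (l + 1) ω ∈ B) ∧ v ≤ F.card} →
      ω ∈ ⋃ n, (R n ∪ E n ∩ Q n) := by
    filter_upwards [hpos, hex] with ω hω hn hbad
    obtain ⟨n, hn1, hn2⟩ := hn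
    by_contra hcon
    simp only [Set.mem_iUnion, not_exists, Set.mem_union, not_or] at hcon
    obtain ⟨hR, hEQ⟩ := hcon n
    have hQn : ω ∉ Q n := fun h => hEQ ⟨⟨hn1, hn2⟩, h⟩
    have hR' : ∑ i ∈ Finset.range (n + 1), G i ω ≤ s + x := by
      by_contra h; exact hR ⟨hn1, not_le.1 h⟩
    simp only [Q, Set.mem_union, not_or] at hQn
    obtain ⟨hQ0, hQ1, hQ2⟩ := hQn
    simp only [C, Set.mem_ofPred_eq, not_le] at hQ0 hQ1 hQ2
    have hend : ∑ i ∈ Finset.range (n + 1 + 2 * N), G i ω ≤ s + T := by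
      rw [← Finset.sum_range_add_sum_Ico _ (by omega : n + 1 ≤ n + 1 + 2 * N)]
      linarith
    have hcard : ∀ c, (∑ i ∈ Finset.range N,
        D.indicator (fun _ => (1 : ℝ)) (G (n + c + 2 * i) ω, G (n + c + 2 * i + 1) ω))
        = (((Finset.range N).filter fun i =>
          (G (n + c + 2 * i) ω, G (n + c + 2 * i + 1) ω) ∈ D).card : ℝ) := by
      intro c
      rw [Finset.card_filter]; push_cast
      refine Finset.sum_congr rfl fun i _ => ?_
      simp [Set.indicator]
    rw [hcard] at hQ1 hQ2
    let I : ℕ → Finset ℕ := fun c => (Finset.range N).filter fun i =>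
          (G (n + c + 2 * i) ω, G (n + c + 2 * i + 1) ω) ∈ D
    have hinj : ∀ c, Function.Injective fun i : ℕ => n + c + 2 * i := fun c i j h => by
      simp only at h; omega
    refine hbad ⟨(I 1).image (fun i => n + 1 + 2 * i) ∪ (I 2).image (fun i => n + 2 + 2 * i),
      ?_, ?_⟩
    · have main : ∀ c, 1 ≤ c → c ≤ 2 → ∀ i ∈ I c,
          s < ∑ j ∈ Finset.range (n + c + 2 * i + 1), G j ω ∧
          ∑ j ∈ Finset.range (n + c + 2 * i + 1), G j ω ≤ s + T ∧
          Δ < G (n + c + 2 * i) ω ∧ G (n + c + 2 * i + 1) ω ∈ B := by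
        intro c hc hc' i hi
        simp only [I, Finset.mem_filter, Finset.mem_range] at hi
        refine ⟨hn2.trans_le (hmono ω hω (by omega)), (hmono ω hω ?_).trans hend, hi.2⟩
        omega
      intro l hl
      simp only [Finset.mem_union, Finset.mem_image] at hl
      rcases hl with ⟨i, hi, rfl⟩ | ⟨i, hi, rfl⟩
      · exact main 1 le_rfl (by norm_num) i hi
      · exact main 2 (by norm_num) le_rfl i hi
    · rw [Finset.card_union_of_disjoint, Finset.card_image_of_injective _ (hinj 1),
        Finset.card_image_of_injective _ (hinj 2)]
      · push_cast; linarith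
      · rw [Finset.disjoint_left]
        intro l
        simp only [Finset.mem_image, not_exists, not_and]
        rintro ⟨i, _, rfl⟩ j _ h
        omega
  have hRn : ∀ n, P (R n) = ENNReal.ofReal (Real.exp (-(α * x))) * P (E n) := fun n =>
    residual_tail hα hm hi hl n s hx
  have hb0 : 0 ≤ b := by
    have : 0 < α - θ := by linarith
    positivity
  -- Each term is at most a fixed multiple of `P (E n)`, by memorylessness for `R n` and by
  -- independence for `E n ∩ Q n`. The sets `E n` are almost disjoint, so summing over `n` costs
  -- nothing.
  calc P _ ≤ P (⋃ n, (R n ∪ E n ∩ Q n)) := measure_mono_ae hsub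
    _ ≤ ∑' n, P (R n ∪ E n ∩ Q n) := measure_iUnion_le _
    _ ≤ ∑' n, ENNReal.ofReal (Real.exp (-(α * x)) + b) * P (E n) := by
        refine ENNReal.tsum_le_tsum fun n => ?_
        refine (measure_union_le _ _).trans ?_
        rw [hRn, hindep, ENNReal.ofReal_add (Real.exp_pos _).le hb0, add_mul, mul_comm (P (E n))]
        gcongr
        exact hQ n
    _ = ENNReal.ofReal (Real.exp (-(α * x)) + b) * ∑' n, P (E n) := ENNReal.tsum_mul_left
    _ ≤ ENNReal.ofReal (Real.exp (-(α * x)) + b) * 1 := by gcongr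
    _ = _ := mul_one _

end Renewal

/-! ### Explicit constants and the race in one window -/

section Window

variable {Ω : Type*} [MeasurableSpace Ω] {P : Measure Ω} [IsProbabilityMeasure P]
  {G : ℕ → Ω → ℝ} {α : ℝ}

/-- The deviations are budgeted so that each of the four failures (late first renewal, waiting times
too long in total, too few pairs of either parity) has probability at most the common exponential.
-/
lemma window_tail_explicit (hα : 0 < α) (hm : ∀ i, Measurable (G i)) (hi : iIndepFun G P)
    (hl : ∀ i, HasLaw (G i) (expMeasure α) P) {s : ℝ}
    (hex : ∀ᵐ ω ∂P, ∃ n, ∑ i ∈ Finset.range n, G i ω ≤ s ∧ s < ∑ i ∈ Finset.range (n + 1), G i ω)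
    {Δ : ℝ} {B : Set ℝ} (hB : MeasurableSet B) {p : ℝ}
    (hp : ∀ i, P.real {ω | Δ < G i ω ∧ G (i + 1) ω ∈ B} = p)
    {δ T : ℝ} (hδ : 0 < δ) (hδ' : δ < 1 / 2) (hT : 100 ≤ δ * (α * T)) :
    P {ω | ¬ ∃ F : Finset ℕ, (∀ l ∈ F, s < ∑ i ∈ Finset.range (l + 1), G i ω ∧
        ∑ i ∈ Finset.range (l + 1), G i ω ≤ s + T ∧ Δ < G l ω ∧ G (l + 1) ω ∈ B) ∧
        (1 - 1.52 * δ) * (p * (α * T)) ≤ F.card}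
      ≤ ENNReal.ofReal (4 * Real.exp (-(δ ^ 2 * (p * (α * T)) / 54))) := by
  have hp0 : 0 ≤ p := by rw [← hp 0]; exact measureReal_nonneg
  have hp1 : p ≤ 1 := by rw [← hp 0]; exact measureReal_le_one
  set K := α * T with hK
  have hKpos : 0 < K := by
    by_contra h
    nlinarith
  have hK200 : 200 ≤ K := by nlinarith
  -- The `2 * N` waiting times last about `(1 - 0.7 δ) T` on average; after `δ T / 10` is set aside
  -- for the first renewal, `0.6 δ T` remains as a margin.
  set N : ℕ := ⌊(1 - 0.7 * δ) * K / 2⌋₊ with hN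
  have hN0 : 0 ≤ (1 - 0.7 * δ) * K / 2 := by
    have : 0 ≤ 1 - 0.7 * δ := by linarith
    positivity
  have hN1 : (N : ℝ) ≤ (1 - 0.7 * δ) * K / 2 := Nat.floor_le hN0
  have hN2 : (1 - 0.7 * δ) * K / 2 - 1 < N := by
    have := Nat.lt_floor_add_one ((1 - 0.7 * δ) * K / 2)
    rw [← hN] at this
    linarith
  have hNK : 0.3 * K ≤ N := by nlinarith
  -- Here `1.52 = 0.7 + 0.8 + 0.02`, where `0.02 δ K ≥ 2` pays for the rounding in `N`.
  have hv : (1 - 1.52 * δ) * (p * K) ≤ 2 * ((1 - 0.8 * δ) * (p * N)) := by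
    have h1 : (1 - 1.52 * δ) * K ≤ 2 * ((1 - 0.8 * δ) * N) := by
      have : (1 - 0.8 * δ) * ((1 - 0.7 * δ) * K / 2 - 1) ≤ (1 - 0.8 * δ) * N :=
        mul_le_mul_of_nonneg_left hN2.le (by linarith)
      nlinarith [mul_pos (mul_pos hδ hδ) hKpos]
    nlinarith [mul_le_mul_of_nonneg_left h1 hp0]
  have h := window_tail hα hm hi hl hex hB hp (x := δ * T / 10) (y := 0.8 * δ)
    (θ := 0.3 * δ * α) (T := T) (N := N) (v := (1 - 1.52 * δ) * (p * K))
    (by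
      have : 0 < T := by
        by_contra h
        nlinarith
      positivity) (by positivity) (by linarith) (by positivity) (by nlinarith) hv
  refine h.trans (ENNReal.ofReal_le_ofReal ?_)
  have hd2 : δ ^ 2 ≤ δ := by nlinarith
  have hmain : δ ^ 2 * (p * K) / 54 ≤ δ ^ 2 * K / 54 := by
    have : p * K ≤ K := by nlinarith
    gcongr
  have e1 : Real.exp (-(α * (δ * T / 10))) ≤ Real.exp (-(δ ^ 2 * (p * K) / 54)) := by
    refine Real.exp_le_exp.2 (neg_le_neg ?_)
    have : α * (δ * T / 10) = δ * K / 10 := by rw [hK]; ring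
    rw [this]
    nlinarith [mul_le_mul_of_nonneg_right hd2 hKpos.le, mul_pos hδ hKpos]
  have e3 : Real.exp (-((0.8 * δ) ^ 2 / 4 * (p * N))) ≤ Real.exp (-(δ ^ 2 * (p * K) / 54)) := by
    refine Real.exp_le_exp.2 (neg_le_neg ?_)
    have h1 : δ ^ 2 * (p * (0.3 * K)) ≤ δ ^ 2 * (p * N) := by gcongr
    have h2 : 0 ≤ δ ^ 2 * (p * K) := by positivity
    nlinarith
  have e2 : Real.exp (-(0.3 * δ * α) * (T - δ * T / 10)) * (α / (α - 0.3 * δ * α)) ^ (2 * N)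
      ≤ Real.exp (-(δ ^ 2 * (p * K) / 54)) := by
    have hz : 0 < 1 - 0.3 * δ := by linarith
    have h1 : α / (α - 0.3 * δ * α) = 1 / (1 - 0.3 * δ) := by
      field_simp
    have h2 : 1 / (1 - 0.3 * δ) ≤ Real.exp (0.3 * δ + 0.108 * δ ^ 2) := by
      have h3 : 1 / (1 - 0.3 * δ) ≤ 0.3 * δ + 0.108 * δ ^ 2 + 1 := by
        rw [div_le_iff₀ hz]
        nlinarith [mul_pos hδ (mul_pos hδ hδ), mul_pos hδ hδ]
      exact h3.trans (Real.add_one_le_exp _)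
    rw [h1]
    calc _ ≤ Real.exp (-(0.3 * δ * α) * (T - δ * T / 10)) *
          (Real.exp (0.3 * δ + 0.108 * δ ^ 2)) ^ (2 * N) := by gcongr
      _ = Real.exp (-(0.3 * δ * K * (1 - δ / 10)) + (2 * N) * (0.3 * δ + 0.108 * δ ^ 2)) := by
          rw [← Real.exp_nat_mul, ← Real.exp_add]
          congr 1
          rw [hK]; push_cast; ring
      _ ≤ _ := by
          refine Real.exp_le_exp.2 ?_
          have h4 : (2 * N) * (0.3 * δ + 0.108 * δ ^ 2)
              ≤ ((1 - 0.7 * δ) * K) * (0.3 * δ + 0.108 * δ ^ 2) := by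
            have : 0 ≤ 0.3 * δ + 0.108 * δ ^ 2 := by positivity
            nlinarith [mul_le_mul_of_nonneg_right hN1 this]
          have h5 : 0 ≤ δ ^ 3 * K := by positivity
          have h6 : 0 ≤ δ ^ 2 * K := by positivity
          nlinarith
  linarith

/-- A counting variable dominated by a Poisson variable rarely exceeds its mean substantially. -/
lemma dominated_tail {Z : Ω → ℕ} (hZ : Measurable Z) {l : ℝ} (hl : 0 ≤ l)
    (hdom : ∀ a : ℕ, Real.exp (-l) * ∑ i ∈ Finset.range (a + 1), l ^ i / (i.factorial : ℝ)
      ≤ P.real {ω | Z ω ≤ a})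
    {δ M : ℝ} (hδ : 0 < δ) (hδ' : δ < 1 / 2) (hM : 0 < M) (hlM : l ≤ (1 - 2 * δ) * M) :
    P {ω | (1 - 1.52 * δ) * M ≤ Z ω} ≤ ENNReal.ofReal (Real.exp (-(δ ^ 2 * M / 54))) := by
  have hpos : 0 < (1 - 1.52 * δ) * M := mul_pos (by linarith) hM
  set c : ℕ := ⌈(1 - 1.52 * δ) * M⌉₊ with hc
  have hc0 : 0 < c := Nat.ceil_pos.2 hpos
  obtain ⟨a, ha⟩ : ∃ a, c = a + 1 := ⟨c - 1, by omega⟩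
  have hca : (1 - 1.52 * δ) * M ≤ a + 1 := by
    have := Nat.le_ceil ((1 - 1.52 * δ) * M)
    rw [← hc, ha] at this
    exact_mod_cast this
  have hms : MeasurableSet {ω | Z ω ≤ a} := hZ (measurableSet_Iic (a := a))
  have hset : {ω | (1 - 1.52 * δ) * M ≤ Z ω} ⊆ {ω | Z ω ≤ a}ᶜ := by
    intro ω hω hle
    simp only [Set.mem_ofPred_eq] at hω hle
    have : c ≤ Z ω := Nat.ceil_le.2 hω
    omega
  refine (measure_mono hset).trans ?_
  rw [← ofReal_measureReal]
  refine ENNReal.ofReal_le_ofReal ?_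
  rw [probReal_compl_eq_one_sub hms]
  -- With this `θ` the coefficient of `δ² M` in the exponent is `0.4 * 1.52 - 0.8 + 0.16 = -0.032`,
  -- which is below `-1/54`.
  have h1 := poisson_tail hl (θ := 0.4 * δ) (by positivity) a
  have h2 := hdom a
  refine (by linarith : _ ≤ Real.exp (-(0.4 * δ * (a + 1)) + l * (Real.exp (0.4 * δ) - 1))).trans ?_
  refine Real.exp_le_exp.2 ?_
  have h3 : Real.exp (0.4 * δ) - 1 ≤ 0.4 * δ + (0.4 * δ) ^ 2 := by
    have h := (abs_le.1 (Real.abs_exp_sub_one_sub_id_le (x := 0.4 * δ) (by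
      rw [abs_le]; constructor <;> linarith))).2
    linarith
  have h4 : l * (Real.exp (0.4 * δ) - 1) ≤ ((1 - 2 * δ) * M) * (0.4 * δ + (0.4 * δ) ^ 2) := by
    have : 0 ≤ Real.exp (0.4 * δ) - 1 := by
      have := Real.add_one_le_exp (0.4 * δ)
      nlinarith
    exact mul_le_mul hlM h3 this (hl.trans hlM)
  have h5 := mul_le_mul_of_nonneg_left hca (by positivity : 0 ≤ 0.4 * δ)
  have h6 : 0 ≤ δ ^ 2 * M := by positivity
  have h7 : 0 ≤ δ ^ 3 * M := by positivity
  nlinarith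

/-- In a time window the adversarial blocks are outnumbered by the renewals that
follow a waiting time exceeding `Δ` and precede one in `B`. -/
lemma window_race (hα : 0 < α) (hm : ∀ i, Measurable (G i)) (hi : iIndepFun G P)
    (hl : ∀ i, HasLaw (G i) (expMeasure α) P) {s : ℝ}
    (hex : ∀ᵐ ω ∂P, ∃ n, ∑ i ∈ Finset.range n, G i ω ≤ s ∧ s < ∑ i ∈ Finset.range (n + 1), G i ω)
    {Δ : ℝ} {B : Set ℝ} (hB : MeasurableSet B) {p : ℝ} (hp0 : 0 < p)
    (hp : ∀ i, P.real {ω | Δ < G i ω ∧ G (i + 1) ω ∈ B} = p)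
    {δ T : ℝ} (hδ : 0 < δ) (hδ' : δ < 1 / 2) (hT : 100 ≤ δ * (α * T))
    {Z : Ω → ℕ} (hZ : Measurable Z) {l : ℝ} (hl0 : 0 ≤ l)
    (hdom : ∀ a : ℕ, Real.exp (-l) * ∑ i ∈ Finset.range (a + 1), l ^ i / (i.factorial : ℝ)
      ≤ P.real {ω | Z ω ≤ a}) (hlM : l ≤ (1 - 2 * δ) * (p * (α * T))) :
    P {ω | ¬ ∃ F : Finset ℕ, (∀ l ∈ F, s < ∑ i ∈ Finset.range (l + 1), G i ω ∧
        ∑ i ∈ Finset.range (l + 1), G i ω ≤ s + T ∧ Δ < G l ω ∧ G (l + 1) ω ∈ B) ∧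
        Z ω < F.card}
      ≤ ENNReal.ofReal (5 * Real.exp (-(δ ^ 2 * (p * (α * T)) / 54))) := by
  have hK : 0 < α * T := by
    by_contra h
    nlinarith
  have h1 := window_tail_explicit hα hm hi hl hex hB hp hδ hδ' hT
  have h2 := dominated_tail hZ hl0 hdom hδ hδ' (mul_pos hp0 hK) hlM
  set e := Real.exp (-(δ ^ 2 * (p * (α * T)) / 54)) with he
  have he0 : 0 ≤ e := (Real.exp_pos _).le
  have h5 : ENNReal.ofReal (5 * e) = ENNReal.ofReal (4 * e) + ENNReal.ofReal e := by
    rw [← ENNReal.ofReal_add (by positivity) he0]; congr 1; ring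
  rw [h5]
  refine (measure_mono ?_).trans ((measure_union_le _ _).trans (add_le_add h1 h2))
  intro ω hω
  by_contra hcon
  simp only [Set.mem_union, not_or, Set.mem_ofPred_eq, not_not, not_le] at hcon
  obtain ⟨⟨F, hF, hcard⟩, hZ'⟩ := hcon
  exact hω ⟨F, hF, by exact_mod_cast hZ'.trans_le hcard⟩

omit [IsProbabilityMeasure P] in
/-- The probability that a waiting time exceeds `Δ`. -/
lemma prob_gap (hα : 0 < α) (hl : ∀ i, HasLaw (G i) (expMeasure α) P) {Δ : ℝ} (hΔ : 0 ≤ Δ)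
    (i : ℕ) : P {ω | Δ < G i ω} = ENNReal.ofReal (g α Δ) := by
  rw [(hl i).measure_eq (p := fun x => Δ < x) measurableSet_Ioi, g]
  exact expMeasure_Ioi hα hΔ

omit [IsProbabilityMeasure P] in
lemma prob_gap_univ (hα : 0 < α) (hl : ∀ i, HasLaw (G i) (expMeasure α) P) {Δ : ℝ} (hΔ : 0 ≤ Δ)
    (i : ℕ) : P.real {ω | Δ < G i ω ∧ G (i + 1) ω ∈ Set.univ} = g α Δ := by
  simp only [Set.mem_univ, and_true]
  rw [measureReal_def, prob_gap hα hl hΔ, ENNReal.toReal_ofReal]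
  exact (Real.exp_pos _).le

omit [IsProbabilityMeasure P] in
lemma prob_gap_pair (hα : 0 < α) (hi : iIndepFun G P)
    (hl : ∀ i, HasLaw (G i) (expMeasure α) P) {Δ : ℝ} (hΔ : 0 ≤ Δ)
    (i : ℕ) : P.real {ω | Δ < G i ω ∧ G (i + 1) ω ∈ Set.Ioi Δ} = g α Δ ^ 2 := by
  have h := (hi.indepFun (show i ≠ i + 1 by omega)).measure_inter_preimage_eq_mul (Set.Ioi Δ)
    (Set.Ioi Δ) measurableSet_Ioi measurableSet_Ioi
  have e : G i ⁻¹' Set.Ioi Δ ∩ G (i + 1) ⁻¹' Set.Ioi Δ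
      = {ω | Δ < G i ω ∧ G (i + 1) ω ∈ Set.Ioi Δ} := by ext ω; simp
  have e' : ∀ i, G i ⁻¹' Set.Ioi Δ = {ω | Δ < G i ω} := fun i => by ext ω; simp
  rw [e, e', e', prob_gap hα hl hΔ, prob_gap hα hl hΔ] at h
  have hg : 0 ≤ g α Δ := (Real.exp_pos _).le
  rw [measureReal_def, h, ENNReal.toReal_mul, ENNReal.toReal_ofReal hg, sq]

end Window

/-! ### Blockchains, heights and adversarial counts -/

section Chains

variable {m : ℕ} {Tx : Type*} {H : History m Tx} {Δ : ℝ}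

namespace History

lemma mem_chain_self (j : Fin (m + 1)) (k : ℕ) : k ∈ H.chain j k := ⟨0, rfl⟩

lemma mem_chain_trans {j : Fin (m + 1)} {a b c : ℕ} (h : a ∈ H.chain j b) (h' : b ∈ H.chain j c) :
    a ∈ H.chain j c := by
  obtain ⟨n, rfl⟩ := h
  obtain ⟨n', rfl⟩ := h'
  exact ⟨n + n', Function.iterate_add_apply _ _ _ _⟩

lemma parent_mem_chain (j : Fin (m + 1)) (k : ℕ) : H.parent j k ∈ H.chain j k := ⟨1, rfl⟩

lemma mem_chain_total {j : Fin (m + 1)} {a b c : ℕ} (ha : a ∈ H.chain j c) (hb : b ∈ H.chain j c) :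
    a ∈ H.chain j b ∨ b ∈ H.chain j a := by
  obtain ⟨n, rfl⟩ := ha
  obtain ⟨n', rfl⟩ := hb
  rcases le_total n n' with h | h
  · right
    refine ⟨n' - n, ?_⟩
    rw [← Function.iterate_add_apply, Nat.sub_add_cancel h]
  · left
    refine ⟨n - n', ?_⟩
    rw [← Function.iterate_add_apply, Nat.sub_add_cancel h]

namespace Follows

variable (hF : H.Follows Δ)
include hF

lemma parent_lt {j : Fin (m + 1)} {k : ℕ} (hk : k ≠ 0) : H.parent j k < k := by
  by_contra h
  exact absurd (hF.mined_mono j (not_lt.1 h)) (not_le.2 (hF.mined_parent_lt j k hk))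

lemma mined_nonneg (x : Block m) : 0 ≤ H.mined x := by
  have := hF.mined_mono x.1 (Nat.zero_le x.2)
  simpa [hF.mined_genesis] using this

lemma exists_iterate_eq_zero (j : Fin (m + 1)) (k : ℕ) : ∃ n, (H.parent j)^[n] k = 0 := by
  induction k using Nat.strong_induction_on with
  | _ k ih =>
    rcases eq_or_ne k 0 with rfl | hk
    · exact ⟨0, rfl⟩
    · obtain ⟨n, hn⟩ := ih _ (hF.parent_lt (j := j) hk)
      exact ⟨n + 1, by rwa [Function.iterate_succ_apply]⟩

omit hF in
lemma height_zero (j : Fin (m + 1)) : H.height j 0 = 0 :=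
  Nat.sInf_eq_zero.2 (Or.inl rfl)

lemma height_eq_succ {j : Fin (m + 1)} {k : ℕ} (hk : k ≠ 0) :
    H.height j k = H.height j (H.parent j k) + 1 := by
  have h1 : (H.parent j)^[H.height j (H.parent j k)] (H.parent j k) = 0 :=
    Nat.sInf_mem (hF.exists_iterate_eq_zero j (H.parent j k))
  have h2 : (H.parent j)^[H.height j k] k = 0 := Nat.sInf_mem (hF.exists_iterate_eq_zero j k)
  apply le_antisymm
  · exact Nat.sInf_le (by rwa [Set.mem_ofPred_eq, Function.iterate_succ_apply])
  · rcases h : H.height j k with _ | n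
    · rw [h] at h2; exact absurd h2 hk
    · rw [h, Function.iterate_succ_apply] at h2
      exact Nat.succ_le_succ (Nat.sInf_le h2)

lemma height_eq_zero {j : Fin (m + 1)} {k : ℕ} (h : H.height j k = 0) : k = 0 := by
  by_contra hk
  rw [hF.height_eq_succ hk] at h
  omega

/-- Induction along a blockchain. -/
lemma chain_induction {j : Fin (m + 1)} {p : ℕ → ℕ → Prop} (hrefl : ∀ k, p k k)
    (hstep : ∀ a k, k ≠ 0 → a ∈ H.chain j (H.parent j k) → p a (H.parent j k) → p a k)
    {a k : ℕ} (h : a ∈ H.chain j k) : p a k := by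
  induction k using Nat.strong_induction_on with
  | _ k ih =>
    obtain ⟨n, hn⟩ := h
    rcases n with _ | n
    · obtain rfl : k = a := hn
      exact hrefl _
    · rcases eq_or_ne k 0 with rfl | hk
      · have : (H.parent j)^[n + 1] 0 = 0 :=
          Function.iterate_fixed (hF.parent_genesis j) _
        rw [this] at hn
        rw [← hn]; exact hrefl _
      · have h' : a ∈ H.chain j (H.parent j k) := ⟨n, by rwa [Function.iterate_succ_apply] at hn⟩
        exact hstep a k hk h' (ih _ (hF.parent_lt hk) h')

lemma mined_le_of_mem_chain {j : Fin (m + 1)} {a k : ℕ} (h : a ∈ H.chain j k) :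
    H.mined (j, a) ≤ H.mined (j, k) :=
  hF.chain_induction (p := fun a k => H.mined (j, a) ≤ H.mined (j, k)) (fun _ => le_rfl)
    (fun _ k hk _ ih => ih.trans (hF.mined_parent_lt j k hk).le) h

lemma published_le_of_mem_chain {j : Fin (m + 1)} {a k : ℕ} (h : a ∈ H.chain j k) :
    H.published (j, a) ≤ H.published (j, k) :=
  hF.chain_induction (p := fun a k => H.published (j, a) ≤ H.published (j, k)) (fun _ => le_rfl)
    (fun _ k _ _ ih => ih.trans (hF.published_parent_le j k)) h

lemma height_le_of_mem_chain {j : Fin (m + 1)} {a k : ℕ} (h : a ∈ H.chain j k) :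
    H.height j a ≤ H.height j k :=
  hF.chain_induction (p := fun a k => H.height j a ≤ H.height j k) (fun _ => le_rfl)
    (fun _ k hk _ ih => ih.trans (by rw [hF.height_eq_succ hk]; omega)) h

lemma mined_lt_of_mem_chain {j : Fin (m + 1)} {a k : ℕ} (h : a ∈ H.chain j k) (hne : a ≠ k) :
    H.mined (j, a) < H.mined (j, k) :=
  hF.chain_induction (p := fun a k => a ≠ k → H.mined (j, a) < H.mined (j, k))
    (fun _ h => absurd rfl h)
    (fun _ k hk h' _ _ => (hF.mined_le_of_mem_chain h').trans_lt (hF.mined_parent_lt j k hk)) h hne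

lemma zero_mem_chain (j : Fin (m + 1)) (k : ℕ) : 0 ∈ H.chain j k := hF.exists_iterate_eq_zero j k

lemma exists_mem_chain_height {j : Fin (m + 1)} {k ℓ : ℕ} (h : ℓ ≤ H.height j k) :
    ∃ a ∈ H.chain j k, H.height j a = ℓ := by
  induction k using Nat.strong_induction_on with
  | _ k ih =>
    rcases h.eq_or_lt with h' | h'
    · exact ⟨k, mem_chain_self j k, h'.symm⟩
    · have hk : k ≠ 0 := by
        rintro rfl
        rw [height_zero] at h'; omega
      rw [hF.height_eq_succ hk] at h'
      obtain ⟨a, ha, hb⟩ := ih _ (hF.parent_lt hk) (Nat.lt_succ_iff.1 h')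
      exact ⟨a, mem_chain_trans ha (parent_mem_chain j k), hb⟩

/-- On a blockchain, blocks of lower height are mined earlier. -/
lemma mined_lt_of_height_lt {j : Fin (m + 1)} {a b c : ℕ} (ha : a ∈ H.chain j c)
    (hb : b ∈ H.chain j c) (h : H.height j a < H.height j b) :
    H.mined (j, a) < H.mined (j, b) := by
  rcases mem_chain_total ha hb with h' | h'
  · exact hF.mined_lt_of_mem_chain h' (by rintro rfl; omega)
  · have := hF.height_le_of_mem_chain h'
    omega

/-- Honest blocks mined at least `Δ` apart have different heights. -/
lemma height_lt_of_mined_add_le (hΔ : 0 < Δ) {j : Fin (m + 1)} {a b : ℕ} (ha : H.honest (j, a))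
    (hb : H.honest (j, b)) (h : H.mined (j, a) + Δ ≤ H.mined (j, b)) :
    H.height j a < H.height j b := by
  have hb0 : b ≠ 0 := by
    rintro rfl
    rw [hF.mined_genesis] at h
    linarith [hF.mined_nonneg (j, a)]
  rw [hF.height_eq_succ hb0]
  -- Block `a` is published at least `Δ` before `b` is mined, so the credible parent of `b` is at
  -- least as high as `a`.
  refine Nat.lt_succ_of_le ((hF.honest_parent j b hb hb0).2 a ?_)
  rw [hF.honest_published _ ha]
  exact WithTop.coe_le_coe.2 (by linarith)

lemma finite_mined_le (j : Fin (m + 1)) (x : ℝ) : {k | H.mined (j, k) ≤ x}.Finite := by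
  obtain ⟨N, hN⟩ := eventually_atTop.1 ((hF.mined_tendsto j).eventually_gt_atTop x)
  refine (Set.finite_Iio N).subset fun k hk => ?_
  by_contra h
  exact absurd (hN k (not_lt.1 h)) (not_lt.2 hk)

lemma card_le_adversarialCount {j : Fin (m + 1)} {s t : ℝ} {F : Finset ℕ} {f : ℕ → ℕ}
    (hf : Set.InjOn f F) (h : ∀ l ∈ F, ¬ H.honest (j, f l) ∧ s < H.mined (j, f l) ∧
      H.mined (j, f l) ≤ t) : F.card ≤ adversarialCount H j s t := by
  have hfin : {k : ℕ | ¬ H.honest (j, k) ∧ s < H.mined (j, k) ∧ H.mined (j, k) ≤ t}.Finite :=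
    (hF.finite_mined_le j t).subset fun k hk => hk.2.2
  rw [adversarialCount, Set.ncard_eq_toFinset_card _ hfin]
  exact Finset.card_le_card_of_injOn f (fun l hl => by simpa using h l hl) hf

lemma adversarialCount_mono {j : Fin (m + 1)} {s s' t t' : ℝ} (hs : s' ≤ s) (ht : t ≤ t') :
    adversarialCount H j s t ≤ adversarialCount H j s' t' := by
  refine Set.ncard_le_ncard ?_ ((hF.finite_mined_le j t').subset fun k hk => hk.2.2)
  rintro k ⟨h1, h2, h3⟩
  exact ⟨h1, hs.trans_lt h2, h3.trans ht⟩

end Follows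

end History

/-! ### What winning the races implies for heights and chains -/

section HonestTimes

variable {j : Fin (m + 1)}

/-- The number of the `i`-th honest `j`-block. -/
noncomputable def honestBlock (H : History m Tx) (j : Fin (m + 1)) (i : ℕ) : ℕ :=
  Nat.nth (fun k => H.honest (j, k)) i

lemma honestTime_eq (H : History m Tx) (j : Fin (m + 1)) (i : ℕ) :
    honestTime H j i = H.mined (j, honestBlock H j i) := rfl

variable (hF : H.Follows Δ) (hpos : ∀ i, 0 < honestTime H j (i + 1) - honestTime H j i)

include hpos in
-- Beyond the end of a finite set `Nat.nth` returns 0, so the honest times would eventually be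
-- constant and some gap would vanish.
lemma infinite_honest : {k | H.honest (j, k)}.Infinite := by
  intro hfin
  have h : ∀ i, hfin.toFinset.card ≤ i → honestTime H j i = H.mined (j, 0) := by
    intro i hi
    rw [honestTime, Nat.nth_of_card_le hfin hi]
  have := hpos hfin.toFinset.card
  rw [h _ le_rfl, h _ (Nat.le_succ _)] at this
  linarith

include hpos in
lemma honest_honestBlock (i : ℕ) : H.honest (j, honestBlock H j i) :=
  Nat.nth_mem_of_infinite (infinite_honest hpos) i

include hpos in
lemma exists_honestBlock {k : ℕ} (h : H.honest (j, k)) : ∃ i, honestBlock H j i = k := by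
  have := Nat.range_nth_of_infinite (infinite_honest hpos)
  exact this.symm.subset h

include hF in
lemma honestBlock_zero : honestBlock H j 0 = 0 := Nat.nth_zero_of_zero (hF.honest_genesis j)

include hF in
lemma honestTime_zero : honestTime H j 0 = 0 := by
  rw [honestTime_eq, honestBlock_zero hF, hF.mined_genesis]

include hpos in
lemma strictMono_honestTime : StrictMono (honestTime H j) :=
  strictMono_nat_of_lt_succ fun i => by linarith [hpos i]

include hpos in
lemma honestBlock_injective : Function.Injective (honestBlock H j) :=
  (Nat.nth_strictMono (infinite_honest hpos)).injective

include hF hpos in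
lemma finite_honestTime_le (x : ℝ) : {i | honestTime H j i ≤ x}.Finite :=
  Set.Finite.preimage (f := honestBlock H j) (honestBlock_injective hpos).injOn (hF.finite_mined_le j x)

include hF hpos in
lemma tendsto_honestTime : Tendsto (honestTime H j) atTop atTop :=
  (hF.mined_tendsto j).comp (Nat.nth_strictMono (infinite_honest hpos)).tendsto_atTop

include hF in
lemma sum_gap (n : ℕ) : ∑ i ∈ Finset.range n, (honestTime H j (i + 1) - honestTime H j i)
    = honestTime H j n := by
  rw [Finset.sum_range_sub, honestTime_zero hF, sub_zero]

include hF hpos in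
lemma height_lt_of_gap (hΔ : 0 < Δ) {i l : ℕ}
    (hl : Δ < honestTime H j (l + 1) - honestTime H j l) (hi : i ≤ l) :
    H.height j (honestBlock H j i) < H.height j (honestBlock H j (l + 1)) := by
  refine hF.height_lt_of_mined_add_le hΔ (honest_honestBlock hpos _) (honest_honestBlock hpos _) ?_
  have := (strictMono_honestTime hpos).monotone hi
  rw [← honestTime_eq, ← honestTime_eq]
  linarith

include hF hpos in
/-- A block with honest waiting times exceeding `Δ` on both sides is the only honest block of its
height. -/
lemma height_ne_of_gaps (hΔ : 0 < Δ) {i l : ℕ}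
    (hl : Δ < honestTime H j (l + 1) - honestTime H j l)
    (hl' : Δ < honestTime H j (l + 1 + 1) - honestTime H j (l + 1)) (hi : i ≠ l + 1) :
    H.height j (honestBlock H j i) ≠ H.height j (honestBlock H j (l + 1)) := by
  rcases lt_or_gt_of_ne hi with h | h
  · exact (height_lt_of_gap hF hpos hΔ hl (by omega)).ne
  · refine (hF.height_lt_of_mined_add_le hΔ (honest_honestBlock hpos _)
      (honest_honestBlock hpos _) ?_).ne'
    have := (strictMono_honestTime hpos).monotone (show l + 1 + 1 ≤ i by omega)
    rw [← honestTime_eq, ← honestTime_eq]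
    linarith

include hF hpos in
/-- If up to time `t` the adversary cannot match all honest blocks that follow a long waiting time
and are mined by time `p`, then one of those mined after time `s` is not matched. -/
lemma exists_uncontested (hΔ : 0 < Δ) {s p t : ℝ} (hs : 0 ≤ s)
    (hrace : ∀ s₀, 0 ≤ s₀ → s₀ ≤ s → ∃ F : Finset ℕ, (∀ l ∈ F, s₀ < honestTime H j (l + 1) ∧
      honestTime H j (l + 1) ≤ p ∧ Δ < honestTime H j (l + 1) - honestTime H j l) ∧
      adversarialCount H j s₀ t < F.card) :
    ∃ b, H.honest (j, b) ∧ s < H.mined (j, b) ∧ H.mined (j, b) ≤ p ∧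
      ∀ k, H.height j k = H.height j b → H.mined (j, k) ≤ t →
        H.honest (j, k) ∧ H.mined (j, b) ≤ H.mined (j, k) := by
  classical
  have hmono := strictMono_honestTime hpos
  -- earlier honest blocks are lower
  have hlow : ∀ i i', (i = 0 ∨ ∃ l, i = l + 1 ∧ Δ < honestTime H j (l + 1) - honestTime H j l) →
      i' < i → H.height j (honestBlock H j i') < H.height j (honestBlock H j i) := by
    rintro i i' (rfl | ⟨l, rfl, hl⟩) h
    · omega
    · exact height_lt_of_gap hF hpos hΔ hl (by omega)
  -- Candidates for a safe starting point: blocks mined by `s` whose height no adversarial block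
  -- attains by time `t`. Genesis always qualifies, being the only block of height 0.
  let U : Set ℕ := {i | (i = 0 ∨ ∃ l, i = l + 1 ∧ Δ < honestTime H j (l + 1) - honestTime H j l) ∧
    honestTime H j i ≤ s ∧ ∀ k, ¬ H.honest (j, k) → H.mined (j, k) ≤ t →
      H.height j k ≠ H.height j (honestBlock H j i)}
  have hU : U.Finite := (finite_honestTime_le hF hpos s).subset fun i hi => hi.2.1
  have hU0 : U.Nonempty := by
    refine ⟨0, Or.inl rfl, by rwa [honestTime_zero hF], fun k hk _ h => ?_⟩
    rw [honestBlock_zero hF, History.Follows.height_zero] at h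
    rw [hF.height_eq_zero h] at hk
    exact hk (hF.honest_genesis j)
  obtain ⟨i₀, ⟨hi₀, hi₀s, hi₀k⟩, hmax⟩ := Set.exists_max_image U id hU hU0
  -- The race starts at the last safe point. By its maximality and by the negated goal, each block
  -- of `F` is matched by an adversarial one.
  obtain ⟨F, hFl, hcard⟩ := hrace (honestTime H j i₀) (hF.mined_nonneg _) hi₀s
  by_contra hcon
  have hcontest : ∀ l ∈ F, ∃ k, ¬ H.honest (j, k) ∧ H.mined (j, k) ≤ t ∧
      H.height j k = H.height j (honestBlock H j (l + 1)) := by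
    intro l hl
    obtain ⟨h1, h2, h3⟩ := hFl l hl
    by_contra hno
    push Not at hno
    rcases le_or_gt (honestTime H j (l + 1)) s with h | h
    · have := hmax (l + 1) ⟨Or.inr ⟨l, rfl, h3⟩, h, hno⟩
      have h4 := hmono.lt_iff_lt.1 h1
      simp only [id] at this
      omega
    · refine hcon ⟨honestBlock H j (l + 1), honest_honestBlock hpos _, h, h2, fun k hk hkt => ?_⟩
      have hhon : H.honest (j, k) := by
        by_contra h'
        exact hno k h' hkt hk
      refine ⟨hhon, ?_⟩
      obtain ⟨i, rfl⟩ := exists_honestBlock hpos hhon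
      have : l + 1 ≤ i := by
        by_contra h'
        exact absurd hk (height_lt_of_gap hF hpos hΔ h3 (by omega)).ne
      exact hmono.monotone this
  choose! f hf using hcontest
  refine absurd hcard (not_lt.2 (hF.card_le_adversarialCount (f := f) ?_ ?_))
  · intro l hl l' hl' h
    have h1 := (hf l hl).2.2
    rw [h, (hf l' hl').2.2] at h1
    by_contra hne
    rcases lt_or_gt_of_ne hne with h' | h'
    · exact absurd h1.symm (height_lt_of_gap hF hpos hΔ (hFl l' hl').2.2 (by omega)).ne
    · exact absurd h1 (height_lt_of_gap hF hpos hΔ (hFl l hl).2.2 (by omega)).ne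
  · intro l hl
    obtain ⟨h1, h2, h3⟩ := hf l hl
    refine ⟨h1, ?_, h2⟩
    have h4 : i₀ < l + 1 := hmono.lt_iff_lt.1 (hFl l hl).1
    have h5 : H.height j (honestBlock H j i₀) < H.height j (f l) := by
      rw [h3]; exact height_lt_of_gap hF hpos hΔ (hFl l hl).2.2 (by omega)
    -- The chain of `f l` passes the height of the safe point at a block which must be honest and no
    -- earlier than the safe point. Hence `f l` is mined after it and counts in the race.
    obtain ⟨a, ha, hah⟩ := hF.exists_mem_chain_height h5.le
    have hne : a ≠ f l := by rintro rfl; omega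
    have h6 := hF.mined_lt_of_mem_chain ha hne
    have h7 : H.honest (j, a) := by
      by_contra h'
      exact hi₀k a h' (h6.le.trans h2) hah
    obtain ⟨i, rfl⟩ := exists_honestBlock hpos h7
    have h8 : i₀ ≤ i := by
      by_contra h'
      exact absurd hah (hlow i₀ i hi₀ (not_le.1 h')).ne
    exact (hmono.monotone h8).trans_lt h6

include hF hpos in
/-- If in no time interval containing `(s, u₁]` the adversary mines as many blocks as there are
isolated honest ones, then every blockchain that is credible after `u₁` contains an honest block
mined during `(s, u₁]`. -/
lemma exists_honest_mem_chain (hΔ : 0 < Δ) {s u₁ : ℝ} (hs : 0 ≤ s)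
    (hrace : ∀ s₀, 0 ≤ s₀ → s₀ ≤ s → ∀ u₀, u₁ ≤ u₀ → ∃ F : Finset ℕ,
      (∀ l ∈ F, s₀ < honestTime H j (l + 1) ∧ honestTime H j (l + 1) ≤ u₀ - Δ ∧
        Δ < honestTime H j (l + 1) - honestTime H j l ∧
        Δ < honestTime H j (l + 1 + 1) - honestTime H j (l + 1)) ∧
      adversarialCount H j s₀ u₀ < F.card)
    {u : ℝ} (hu : u₁ ≤ u) {c : ℕ} (hc : H.Credible Δ u j c) :
    ∃ v ∈ H.chain j c, H.honest (j, v) ∧ s < H.mined (j, v) ∧ H.mined (j, v) ≤ u₁ := by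
  classical
  by_contra hcon
  push Not at hcon
  have hmono := strictMono_honestTime hpos
  let good : ℕ → Prop := fun l => Δ < honestTime H j (l + 1) - honestTime H j l ∧
        Δ < honestTime H j (l + 1 + 1) - honestTime H j (l + 1)
  -- the last isolated block of the blockchain mined by time `s`
  let U : Set ℕ := {i | (i = 0 ∨ ∃ l, i = l + 1 ∧ good l) ∧
    honestTime H j i ≤ s ∧ honestBlock H j i ∈ H.chain j c}
  have hU : U.Finite := (finite_honestTime_le hF hpos s).subset fun i hi => hi.2.1
  have hU0 : U.Nonempty := by
    refine ⟨0, Or.inl rfl, by rwa [honestTime_zero hF], ?_⟩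
    rw [honestBlock_zero hF]; exact hF.zero_mem_chain j c
  obtain ⟨i₀, ⟨hi₀, hi₀s, hi₀c⟩, hmax⟩ := Set.exists_max_image U id hU hU0
  -- the first isolated block of the blockchain mined after time `u₁`, if there is one
  obtain ⟨u₀, hu₀, hbefore⟩ : ∃ u₀, u₁ ≤ u₀ ∧ ∀ l, good l → honestTime H j (l + 1) ≤ u₀ - Δ →
      (u₁ < honestTime H j (l + 1) → honestBlock H j (l + 1) ∉ H.chain j c) ∧
      ∃ a ∈ H.chain j c, H.height j a = H.height j (honestBlock H j (l + 1)) ∧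
        H.mined (j, a) ≤ u₀ := by
    by_cases hex : ∃ l, good l ∧ u₁ < honestTime H j (l + 1) ∧
        honestBlock H j (l + 1) ∈ H.chain j c
    · obtain ⟨hl1, hl2, hl3⟩ := Nat.find_spec hex
      set l₁ := Nat.find hex with hl₁
      refine ⟨honestTime H j (l₁ + 1), hl2.le, fun l hl hle => ?_⟩
      have hlt : l < l₁ := by
        have := hmono.lt_iff_lt.1 (show honestTime H j (l + 1) < honestTime H j (l₁ + 1) by linarith)
        omega
      refine ⟨fun h h' => Nat.find_min hex hlt ⟨hl, h, h'⟩, ?_⟩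
      have hh := height_lt_of_gap hF hpos hΔ hl1.1 (show l + 1 ≤ l₁ by omega)
      obtain ⟨a, ha, hah⟩ := hF.exists_mem_chain_height hh.le
      exact ⟨a, History.mem_chain_trans ha hl3, hah, hF.mined_le_of_mem_chain ha⟩
    · push Not at hex
      -- Without such a block, `u` itself serves: by credibility the chain is at least as high as
      -- every honest block mined by `u - Δ`.
      refine ⟨u, hu, fun l hl hle => ⟨fun h => hex l hl h, ?_⟩⟩
      have hh : H.height j (honestBlock H j (l + 1)) ≤ H.height j c := by
        refine hc.2 _ ?_
        rw [hF.honest_published _ (honest_honestBlock hpos _)]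
        exact WithTop.coe_le_coe.2 hle
      obtain ⟨a, ha, hah⟩ := hF.exists_mem_chain_height hh
      refine ⟨a, ha, hah, (hF.mined_le_of_mem_chain ha).trans ?_⟩
      exact WithTop.coe_le_coe.1 ((hF.mined_le_published _).trans hc.1)
  obtain ⟨F, hFl, hcard⟩ := hrace (honestTime H j i₀) (hF.mined_nonneg _) hi₀s u₀ hu₀
  have hcontest : ∀ l ∈ F, ∃ k, ¬ H.honest (j, k) ∧ honestTime H j i₀ < H.mined (j, k) ∧
      H.mined (j, k) ≤ u₀ ∧ H.height j k = H.height j (honestBlock H j (l + 1)) := by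
    intro l hl
    obtain ⟨h1, h2, h3⟩ := hFl l hl
    obtain ⟨hnot, a, ha, hah, hau⟩ := hbefore l h3 h2
    have hi₀l : i₀ < l + 1 := hmono.lt_iff_lt.1 h1
    -- Up to `s` this is the maximality of `i₀`, in `(s, u₁]` the negated goal, after `u₁` the
    -- choice of `u₀`.
    have hnotin : honestBlock H j (l + 1) ∉ H.chain j c := by
      intro h
      rcases le_or_gt (honestTime H j (l + 1)) s with h' | h'
      · have := hmax (l + 1) ⟨Or.inr ⟨l, rfl, h3⟩, h', h⟩
        simp only [id] at this
        omega
      · exact hnot (hcon _ h (honest_honestBlock hpos _) h') h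
    -- An isolated block is the only honest one of its height, so the block that the chain has there
    -- instead is adversarial.
    refine ⟨a, fun hhon => ?_, ?_, hau, hah⟩
    · obtain ⟨i, rfl⟩ := exists_honestBlock hpos hhon
      rcases eq_or_ne i (l + 1) with rfl | hne
      · exact hnotin ha
      · exact height_ne_of_gaps hF hpos hΔ h3.1 h3.2 hne hah
    · refine hF.mined_lt_of_height_lt hi₀c ha ?_
      rw [hah]; exact height_lt_of_gap hF hpos hΔ h3.1 (by omega)
  choose! f hf using hcontest
  refine absurd hcard (not_lt.2 (hF.card_le_adversarialCount (f := f) ?_ ?_))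
  · intro l hl l' hl' h
    have h1 := (hf l hl).2.2.2
    rw [h, (hf l' hl').2.2.2] at h1
    by_contra hne
    rcases lt_or_gt_of_ne hne with h' | h'
    · exact absurd h1.symm (height_lt_of_gap hF hpos hΔ (hFl l' hl').2.2.1 (by omega)).ne
    · exact absurd h1 (height_lt_of_gap hF hpos hΔ (hFl l hl).2.2.1 (by omega)).ne
  · intro l hl
    obtain ⟨h1, h2, h3, _⟩ := hf l hl
    exact ⟨h1, h2, h3⟩

end HonestTimes

end Chains

/-! ### Votes, leaders and the ledger -/

section Ledger

variable {m : ℕ} {Tx Out : Type*} {H : History m Tx} {Δ : ℝ}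

lemma conflict_comm {spends : Tx → Set Out} {a b : Tx} :
    Conflict spends a b ↔ Conflict spends b a := by
  rw [Conflict, Conflict, Set.inter_comm]

/-- A transaction that conflicts with no other transaction of an initial segment of a list and
belongs to this segment survives the sanitization of the list. -/
lemma mem_sanitize (spends : Tx → Set Out) {l l' : List Tx} {tx : Tx} (htx : tx ∈ l)
    (h : ∀ y ∈ l, y ≠ tx → ¬ Conflict spends y tx) : tx ∈ sanitize spends (l ++ l') := by
  classical
  have keep : ∀ (l acc : List Tx), tx ∈ acc → tx ∈ l.foldl (fun kept tx =>
      if tx ∈ kept ∨ ∃ tx' ∈ kept, Conflict spends tx' tx then kept else kept ++ [tx]) acc := by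
    intro l
    induction l with
    | nil => exact fun _ h => h
    | cons a l ih =>
      intro acc hacc
      rw [List.foldl_cons]
      refine ih _ ?_
      split_ifs
      · exact hacc
      · exact List.mem_append_left _ hacc
  have main : ∀ (l acc : List Tx), (∀ y ∈ acc, y ≠ tx → ¬ Conflict spends y tx) →
      (∀ y ∈ l, y ≠ tx → ¬ Conflict spends y tx) → tx ∈ l → tx ∈ l.foldl (fun kept tx =>
      if tx ∈ kept ∨ ∃ tx' ∈ kept, Conflict spends tx' tx then kept else kept ++ [tx]) acc := by
    intro l
    induction l with
    | nil => intro _ _ _ h; simp at h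
    | cons a l ih =>
      intro acc hacc hl hmem
      rw [List.foldl_cons]
      by_cases ha : a = tx
      · subst ha
        refine keep _ _ ?_
        split_ifs with hc
        · rcases hc with hc | ⟨y, hy, hc⟩
          · exact hc
          · by_cases hya : y = a
            · rwa [← hya]
            · exact absurd hc (hacc y hy hya)
        · simp
      · refine ih _ ?_ (fun y hy => hl y (List.mem_cons_of_mem _ hy)) ?_
        · intro y hy hne
          split_ifs at hy
          · exact hacc y hy hne
          · rcases List.mem_append.1 hy with hy | hy
            · exact hacc y hy hne
            · rw [List.mem_singleton.1 hy]
              exact hl a List.mem_cons_self ha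
        · exact (List.mem_cons.1 hmem).resolve_left (Ne.symm ha)
  rw [sanitize, List.foldl_append]
  refine keep _ _ ?_
  convert main l [] (by simp) h htx

namespace History.Follows

variable (hF : H.Follows Δ)
include hF

lemma finite_block_mined_le (x : ℝ) : {y : Block m | H.mined y ≤ x}.Finite := by
  refine (Set.finite_iUnion fun j => (hF.finite_mined_le j x).image (Prod.mk j)).subset ?_
  rintro ⟨j, k⟩ h
  exact Set.mem_iUnion.2 ⟨j, k, h, rfl⟩

lemma mined_lt_of_reaches {x y : Block m} (h : H.Reaches x y) : H.mined y < H.mined x := by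
  induction h with
  | single h => exact hF.refs_mined_lt _ _ h
  | tail _ h ih => exact (hF.refs_mined_lt _ _ h).trans ih

lemma published_le_of_reaches {x y : Block m} (h : H.Reaches x y) :
    H.published y ≤ H.published x := by
  induction h with
  | single h => exact hF.published_refs_le _ _ h
  | tail _ h ih => exact (hF.published_refs_le _ _ h).trans ih

lemma finite_epoch (b : ℕ → ℕ) (h : ℕ) : (H.epoch b h).Finite :=
  (hF.finite_block_mined_le (H.mined (0, b h))).subset
    fun _ hx => (hF.mined_lt_of_reaches hx.1).le

/-- An honest proposer block reaches all observable blocks. -/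
lemma reaches_of_observable {k : ℕ} (hk : H.honest (0, k)) {x : Block m}
    (hx : H.Observable (0, k) x) : H.Reaches (0, k) x := by
  by_contra hcon
  -- For the latest unreached observable block, any observable block pointing to it would be mined
  -- later, hence reached, and would pass this on. So nothing observable points to it, and the
  -- honest block must reference it directly.
  let S : Set (Block m) := {y | H.Observable (0, k) y ∧ ¬ H.Reaches (0, k) y}
  have hS : S.Finite := by
    refine (hF.finite_block_mined_le (H.mined (0, k))).subset fun y hy => ?_
    have h1 := (hF.mined_le_published y).trans hy.1.2.le
    rw [hF.honest_published _ hk] at h1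
    exact WithTop.coe_le_coe.1 h1
  obtain ⟨y, ⟨hy1, hy2⟩, hmax⟩ := Set.exists_max_image S H.mined hS ⟨x, hx, hcon⟩
  refine hy2 (Relation.TransGen.single (hF.honest_refs k y hk hy1 fun z hz hzy => ?_))
  have hlt := hF.refs_mined_lt _ _ hzy
  have : H.Reaches (0, k) z := by
    by_contra h
    exact absurd (hmax z ⟨hz, h⟩) (not_le.2 hlt)
  exact hy2 (this.tail hzy)

lemma reaches_of_published_le (hΔ : 0 < Δ) {k : ℕ} (hk : H.honest (0, k)) {x : Block m} {r : ℝ}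
    (hx : H.published x ≤ (r : WithTop ℝ)) (hr : r + Δ ≤ H.mined (0, k)) :
    H.Reaches (0, k) x := by
  refine hF.reaches_of_observable hk ⟨?_, ?_⟩
  · rw [hF.honest_published _ hk]
    calc H.received (0, k) x ≤ H.published x + (Δ : WithTop ℝ) := hF.received_le _ _
      _ ≤ (r : WithTop ℝ) + (Δ : WithTop ℝ) := by gcongr
      _ = ((r + Δ : ℝ) : WithTop ℝ) := (WithTop.coe_add _ _).symm
      _ ≤ _ := WithTop.coe_le_coe.2 hr
  · rw [hF.honest_published _ hk]
    exact hx.trans_lt (WithTop.coe_lt_coe.2 (by linarith))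

lemma lt_of_mem_chain {j : Fin (m + 1)} {a k : ℕ} (h : a ∈ H.chain j k) (hne : a ≠ k) :
    a < k := by
  by_contra h'
  exact absurd (hF.mined_mono j (not_lt.1 h')) (not_le.2 (hF.mined_lt_of_mem_chain h hne))

/-- After an honest voter block that could observe a proposer block of height `ℓ`, a voter
blockchain has a vote on height `ℓ`, and it was cast by that voter block or an ancestor. -/
lemma exists_vote {i : Fin m} {v ℓ : ℕ} (hv : H.honest (i.succ, v)) (hℓ : 1 ≤ ℓ)
    (hp : ∃ p, H.height 0 p = ℓ ∧
      H.published (0, p) ≤ ((H.mined (i.succ, v) - Δ : ℝ) : WithTop ℝ)) :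
    ∃ a ∈ H.chain i.succ v, H.vote i a ℓ ≠ none := by
  by_cases h : H.AncestorVotes i v ℓ
  · obtain ⟨a, ha, _, hav⟩ := h
    exact ⟨a, ha, hav⟩
  · exact ⟨v, mem_chain_self _ _, hF.honest_votes i v ℓ hv hℓ hp h⟩

/-- Ancestors have smaller numbers, so the voting block with the least number casts the vote that
counts. -/
lemma exists_chainVotes {i : Fin m} {v c ℓ : ℕ} (hvc : v ∈ H.chain i.succ c)
    (hv : ∃ a ∈ H.chain i.succ v, H.vote i a ℓ ≠ none) : ∃ p, H.ChainVotes i c ℓ p := by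
  classical
  obtain ⟨h1, h2⟩ := Nat.find_spec hv
  obtain ⟨p, hp⟩ := Option.ne_none_iff_exists'.1 h2
  refine ⟨p, Nat.find hv, mem_chain_trans h1 hvc, hp, ?_⟩
  rintro ⟨a, ha, hne, hav⟩
  exact Nat.find_min hv (hF.lt_of_mem_chain ha hne) ⟨mem_chain_trans ha h1, hav⟩

omit hF in
-- A vote cast after `v` is preceded by one from `v` or its ancestors and does not count. This fixes
-- the time by which all counted votes are cast.
lemma mem_chain_of_chainVotes {i : Fin m} {v c ℓ p : ℕ} (hvc : v ∈ H.chain i.succ c)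
    (hv : ∃ a ∈ H.chain i.succ v, H.vote i a ℓ ≠ none) (hp : H.ChainVotes i c ℓ p) :
    ∃ a ∈ H.chain i.succ v, H.vote i a ℓ = some p := by
  obtain ⟨a, hac, hap, hno⟩ := hp
  by_cases h : a ∈ H.chain i.succ v
  · exact ⟨a, h, hap⟩
  · have h' : v ∈ H.chain i.succ a := (mem_chain_total hac hvc).resolve_left h
    obtain ⟨a', ha', hv'⟩ := hv
    exact absurd ⟨a', mem_chain_trans ha' h', fun he => h (he ▸ ha'), hv'⟩ hno

end History.Follows

/-- Suppose an honest proposer block `b` mined after `r + Δ` is followed by an honest block in each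
credible voter blockchain, and all proposer blocks of the same height mined by time `t` are honest
and later than `b`. Then the transactions published by time `r` are permanent after `t` if they
are credible until `t`. -/
lemma permanentAfter_of_uncontested (hF : H.Follows Δ) (hΔ : 0 < Δ) (hm : 1 ≤ m)
    {spends : Tx → Set Out} {r p t : ℝ} (hpt : p + Δ ≤ t) {b : ℕ} (hb : H.honest (0, b))
    (hrb : r + Δ < H.mined (0, b)) (hbp : H.mined (0, b) ≤ p)
    (hbt : ∀ k, H.height 0 k = H.height 0 b → H.mined (0, k) ≤ t →
        H.honest (0, k) ∧ H.mined (0, b) ≤ H.mined (0, k))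
    (hvoter : ∀ (i : Fin m) (u : ℝ), t ≤ u → ∀ c, H.Credible Δ u i.succ c →
      ∃ v ∈ H.chain i.succ c, H.honest (i.succ, v) ∧ p + Δ < H.mined (i.succ, v) ∧
        H.mined (i.succ, v) ≤ t)
    {tx : Tx} (htx : CredibleUntil spends H t tx) {x : Block m} (hx : tx ∈ H.txs x)
    (hxr : H.published x ≤ (r : WithTop ℝ)) : PermanentAfter spends H Δ t tx := by
  classical
  rintro u htu n B ⟨hn, -, c, hc, hB⟩
  have hr0 : 0 ≤ r :=
    (hF.mined_nonneg x).trans (WithTop.coe_le_coe.1 ((hF.mined_le_published x).trans hxr))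
  have hb0 : b ≠ 0 := by
    rintro rfl
    rw [hF.mined_genesis] at hrb
    linarith
  set h := H.height 0 b with hh
  have hh1 : 1 ≤ h := by
    by_contra h0
    exact hb0 (hF.height_eq_zero (j := 0) (by omega))
  have hhn : h ≤ n := by
    refine hn b ?_
    rw [hF.honest_published _ hb]
    exact WithTop.coe_le_coe.2 (by linarith)
  choose v hvc hvh hvp hvt using fun i => hvoter i u htu (c i) (hc i)
  -- The chain of `b` supplies a proposer block of each height up to `h`, published by `p` and thus
  -- at least `Δ` before `v i` is mined.
  have hvote : ∀ i ℓ, 1 ≤ ℓ → ℓ ≤ h → ∃ a ∈ H.chain i.succ (v i), H.vote i a ℓ ≠ none := by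
    intro i ℓ hℓ hℓh
    refine hF.exists_vote (hvh i) hℓ ?_
    obtain ⟨q, hq, hqℓ⟩ := hF.exists_mem_chain_height hℓh
    refine ⟨q, hqℓ, (hF.published_le_of_mem_chain hq).trans ?_⟩
    rw [hF.honest_published _ hb]
    exact WithTop.coe_le_coe.2 (by linarith [hvp i])
  have hvoted : ∀ i ℓ, 1 ≤ ℓ → ℓ ≤ h → ∀ q, H.ChainVotes i (c i) ℓ q →
      H.height 0 q = ℓ ∧ H.published (0, q) ≤ (t : WithTop ℝ) := by
    intro i ℓ hℓ hℓh q hq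
    obtain ⟨a, ha, haq⟩ := History.Follows.mem_chain_of_chainVotes (hvc i) (hvote i ℓ hℓ hℓh) hq
    refine ⟨hF.vote_height _ _ _ _ haq, (hF.published_refs_le _ _ (hF.vote_refs _ _ _ _ haq)).trans
      ((hF.published_le_of_mem_chain ha).trans ?_)⟩
    rw [hF.honest_published _ (hvh i)]
    exact WithTop.coe_le_coe.2 (hvt i)
  -- There is at least one voter chain, so some candidate has a vote, and therefore so does the
  -- winner. Any block with a counted vote was referenced by a voter block published by `t`.
  have hleader : ∀ ℓ, 1 ≤ ℓ → ℓ ≤ h →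
      H.height 0 (B ℓ) = ℓ ∧ H.published (0, B ℓ) ≤ (t : WithTop ℝ) := by
    intro ℓ hℓ hℓh
    obtain ⟨hne, hBℓ⟩ := hB ℓ hℓ (hℓh.trans hhn)
    have hmem : B ℓ ∈ H.mostVoted u c ℓ := hBℓ ▸ hF.tieBreak_mem _ hne
    let i₀ : Fin m := ⟨0, hm⟩
    obtain ⟨q, hq⟩ := hF.exists_chainVotes (hvc i₀) (hvote i₀ ℓ hℓ hℓh)
    obtain ⟨hqh, hqt⟩ := hvoted i₀ ℓ hℓ hℓh q hq
    have h1 : 0 < H.voteCount c ℓ q := (Set.ncard_pos (Set.toFinite _)).2 ⟨i₀, hq⟩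
    have h2 := h1.trans_le (hmem.2 q ⟨hqh, hqt.trans (WithTop.coe_le_coe.2 htu)⟩)
    obtain ⟨i, hi⟩ := (Set.ncard_pos (Set.toFinite _)).1 h2
    exact hvoted i ℓ hℓ hℓh _ hi
  have hreach : H.Reaches (0, B h) x := by
    obtain ⟨h1, h2⟩ := hleader h hh1 le_rfl
    have h3 := hbt (B h) h1 (WithTop.coe_le_coe.1 ((hF.mined_le_published _).trans h2))
    exact hF.reaches_of_published_le hΔ h3.1 hxr (hrb.le.trans h3.2)
  have hex : ∃ ℓ, 1 ≤ ℓ ∧ H.Reaches (0, B ℓ) x := ⟨h, hh1, hreach⟩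
  obtain ⟨hℓ1, hℓx⟩ := Nat.find_spec hex
  set ℓ := Nat.find hex with hℓ
  have hℓh : ℓ ≤ h := Nat.find_min' hex ⟨hh1, hreach⟩
  have hepoch : x ∈ H.epoch B ℓ :=
    ⟨hℓx, fun i hi1 hi2 hi3 => Nat.find_min hex hi2 ⟨hi1, hi3⟩⟩
  -- Only the first `h` epochs matter: they contain the transaction and consist of blocks published
  -- by `t`, while later epochs cannot remove what has been kept.
  obtain ⟨d, rfl⟩ := Nat.exists_eq_add_of_le hhn
  rw [ledger, History.rawLedger, List.range_add, List.flatMap_append]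
  refine mem_sanitize spends ?_ ?_
  · refine List.mem_flatMap.2 ⟨ℓ - 1, List.mem_range.2 (by omega), ?_⟩
    rw [Nat.sub_add_cancel hℓ1]
    exact List.mem_flatMap.2 ⟨x, (hF.mem_sort _ (hF.finite_epoch _ _) x).2 hepoch, hx⟩
  · intro y hy hne hconf
    obtain ⟨i, hi, hy⟩ := List.mem_flatMap.1 hy
    obtain ⟨z, hz, hy⟩ := List.mem_flatMap.1 hy
    have hz' := (hF.mem_sort _ (hF.finite_epoch _ _) z).1 hz
    have hi' := List.mem_range.1 hi
    refine htx.2 y hne ?_ (conflict_comm.1 hconf)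
    exact (hF.published_tx_le z y hy).trans ((hF.published_le_of_reaches hz'.1).trans
      (hleader (i + 1) (by omega) (by omega)).2)

end Ledger

/-! ### Races in a random history and the union bound -/

/-- During `(s, s + T]` more honest `j`-blocks follow a waiting time exceeding `Δ` and precede one
in `B` than adversarial `j`-blocks are mined during `(s', u']`. -/
def Race {m : ℕ} {Tx : Type*} (H : History m Tx) (Δ : ℝ) (j : Fin (m + 1)) (B : Set ℝ)
    (s T s' u' : ℝ) : Prop :=
  ∃ F : Finset ℕ, (∀ l ∈ F, s < honestTime H j (l + 1) ∧ honestTime H j (l + 1) ≤ s + T ∧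
    Δ < honestTime H j (l + 1) - honestTime H j l ∧
    honestTime H j (l + 1 + 1) - honestTime H j (l + 1) ∈ B) ∧
    adversarialCount H j s' u' < F.card

section System

variable {Ω : Type*} [MeasurableSpace Ω] {P : Measure Ω} [IsProbabilityMeasure P]
  {m : ℕ} {Tx : Type*} {α β Δ : ℝ} {H : Ω → History m Tx}

omit [IsProbabilityMeasure P] in
lemma IsPrismSystem.ae_gap_pos (hα : 0 < α) (hH : IsPrismSystem P α β Δ H) :
    ∀ᵐ ω ∂P, ∀ j i, 0 < honestTime (H ω) j (i + 1) - honestTime (H ω) j i :=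
  ae_all_iff.2 fun j => ae_all_iff.2 fun i => HasLaw.ae_pos hα (hH.law_gap j i)

/-- In a time window the adversarial blocks of a type are outnumbered by the honest blocks that
follow a waiting time exceeding `Δ` and precede one in `B`. -/
lemma IsPrismSystem.race (hα : 0 < α) (hβ : 0 ≤ β) (hH : IsPrismSystem P α β Δ H)
    (j : Fin (m + 1)) {B : Set ℝ} (hB : MeasurableSet B) {p : ℝ} (hp0 : 0 < p)
    (hp : ∀ i, P.real {ω | Δ < honestTime (H ω) j (i + 1) - honestTime (H ω) j i ∧
      honestTime (H ω) j (i + 1 + 1) - honestTime (H ω) j (i + 1) ∈ B} = p)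
    {δ s T s' u' : ℝ} (hδ : 0 < δ) (hδ' : δ < 1 / 2) (hT : 100 ≤ δ * (α * T)) (hs : 0 ≤ s)
    (hs' : 0 ≤ s') (hsu : s' < u') (hlM : β * (u' - s') ≤ (1 - 2 * δ) * (p * (α * T))) :
    P {ω | ¬ Race (H ω) Δ j B s T s' u'}
      ≤ ENNReal.ofReal (5 * Real.exp (-(δ ^ 2 * (p * (α * T)) / 54))) := by
  have hi : iIndepFun (fun i ω => honestTime (H ω) j (i + 1) - honestTime (H ω) j i) P :=
    hH.indep_gap.precomp (g := fun i : ℕ => (j, i)) fun a b h => (Prod.mk.inj h).2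
  have hex : ∀ᵐ ω ∂P, ∃ n,
      ∑ i ∈ Finset.range n, (honestTime (H ω) j (i + 1) - honestTime (H ω) j i) ≤ s ∧
      s < ∑ i ∈ Finset.range (n + 1), (honestTime (H ω) j (i + 1) - honestTime (H ω) j i) := by
    filter_upwards [hH.ae_gap_pos hα] with ω hω
    classical
    have hF := hH.follows ω
    simp only [sum_gap hF]
    have h := ((tendsto_honestTime hF (hω j)).eventually_gt_atTop s).exists
    have h0 : Nat.find h ≠ 0 := by
      intro h0
      have := Nat.find_spec h
      rw [h0, honestTime_zero hF] at this
      linarith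
    obtain ⟨n, hn⟩ := Nat.exists_eq_succ_of_ne_zero h0
    exact ⟨n, not_lt.1 (Nat.find_min h (by omega)), by simpa [hn] using Nat.find_spec h⟩
  have h := window_race hα (hH.measurable_gap j) hi (hH.law_gap j) hex hB hp0 hp hδ hδ' hT
    (hH.measurable_adversarial j s' u') (mul_nonneg hβ (sub_nonneg.2 hsu.le))
    (hH.adversarial_le j s' u' hs' hsu) hlM
  simp only [sum_gap (hH.follows _)] at h
  exact h

lemma tsum_ofReal_geometric {C q : ℝ} (hC : 0 ≤ C) (hq : 0 ≤ q) (hq' : q < 1) :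
    ∑' n : ℕ, ENNReal.ofReal (C * q ^ n) = ENNReal.ofReal (C * (1 - q)⁻¹) := by
  rw [← ENNReal.ofReal_tsum_of_nonneg (fun n => by positivity)
    ((summable_geometric_of_lt_one hq hq').mul_left C), tsum_mul_left,
    tsum_geometric_of_lt_one hq hq']

omit [IsProbabilityMeasure P] in
/-- Union bound for a doubly geometric family of events. -/
lemma measure_iUnion_geometric {Bad : Fin (m + 1) → ℕ → ℕ → Set Ω} {K q : ℝ} (hK : 0 ≤ K)
    (hq : 0 ≤ q) (hq' : q < 1)
    (h : ∀ j a b, P (Bad j a b) ≤ ENNReal.ofReal (K * q ^ a * q ^ b)) :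
    P (⋃ j, ⋃ a, ⋃ b, Bad j a b) ≤ ENNReal.ofReal ((m + 1) * (K * (1 - q)⁻¹ * (1 - q)⁻¹)) := by
  have h1q : 0 ≤ (1 - q)⁻¹ := inv_nonneg.2 (by linarith)
  have h1 : ∀ j a, P (⋃ b, Bad j a b) ≤ ENNReal.ofReal (K * (1 - q)⁻¹ * q ^ a) := by
    intro j a
    refine (measure_iUnion_le _).trans ((ENNReal.tsum_le_tsum (h j a)).trans ?_)
    rw [tsum_ofReal_geometric (by positivity) hq hq']
    exact le_of_eq (congrArg ENNReal.ofReal (by ring))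
  have h2 : ∀ j, P (⋃ a, ⋃ b, Bad j a b) ≤ ENNReal.ofReal (K * (1 - q)⁻¹ * (1 - q)⁻¹) := by
    intro j
    refine (measure_iUnion_le _).trans ((ENNReal.tsum_le_tsum (h1 j)).trans ?_)
    rw [tsum_ofReal_geometric (by positivity) hq hq']
  refine (measure_iUnion_le _).trans ((ENNReal.tsum_le_tsum h2).trans ?_)
  rw [tsum_fintype, Finset.sum_const, Finset.card_univ, Fintype.card_fin, nsmul_eq_mul,
    ← Nat.cast_add_one, ENNReal.ofReal_mul (Nat.cast_nonneg (m + 1)), ENNReal.ofReal_natCast]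

omit [IsProbabilityMeasure P] in
-- The adversarial window may be longer than the honest one by `w'`: the slack `δ T / 40` between
-- the factors `1 - 81 δ / 40` and `1 - 2 δ` pays for it.
lemma mean_le_of_window {δ γ w w' T : ℝ} (hα : 0 < α) (hγ : 0 < γ) (hδ0 : 0 < δ) (hδ : δ < 40 / 81)
    (hαβ : β < (1 - 81 / 40 * δ) * γ ^ 2 * α) (hw : 0 ≤ w) (hw' : 0 ≤ w') (hwT : w ≤ T + w')
    (hT : 40 * w' ≤ δ * T) : β * w ≤ (1 - 2 * δ) * (γ ^ 2 * (α * T)) := by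
  have hδ1 : 0 < 1 - 81 / 40 * δ := by linarith
  have h1 : (1 - 81 / 40 * δ) * w ≤ (1 - 2 * δ) * T := by
    have h2 := mul_le_mul_of_nonneg_left hwT hδ1.le
    nlinarith [mul_nonneg hδ0.le hw']
  calc β * w ≤ ((1 - 81 / 40 * δ) * γ ^ 2 * α) * w := by gcongr
    _ = γ ^ 2 * α * ((1 - 81 / 40 * δ) * w) := by ring
    _ ≤ γ ^ 2 * α * ((1 - 2 * δ) * T) := by gcongr
    _ = _ := by ring

lemma eta_le (hα : 0 < α) (hΔ : 0 < Δ) {δ : ℝ} (hδ : 0 < δ) (hδ' : δ < 1) :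
    eta α Δ δ ≤ δ * α := by
  have hg0 : 0 < g α Δ := Real.exp_pos _
  have hg1 : g α Δ < 1 := Real.exp_lt_one_iff.2 (by have := mul_pos hα hΔ; linarith)
  have h1 : g α Δ ^ 2 ≤ 1 := pow_le_one₀ hg0.le hg1.le
  have h2 : δ ^ 2 ≤ δ := by nlinarith
  calc eta α Δ δ = δ ^ 2 * g α Δ ^ 2 * α := rfl
    _ ≤ δ * 1 * α := by gcongr
    _ = δ * α := by ring

/-- The race between adversarial proposer blocks and honest ones that follow a long waiting time,
where the adversary has some extra time. -/
lemma IsPrismSystem.proposer_race (hα : 0 < α) (hβ : 0 ≤ β) (hΔ : 0 < Δ) {δ : ℝ} (hδ : 0 < δ)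
    (hδ' : δ < 40 / 81) (hαβ : β < (1 - 81 / 40 * δ) * g α Δ ^ 2 * α)
    (hH : IsPrismSystem P α β Δ H) {s T t : ℝ} (hs : 0 ≤ s) (hT0 : 0 < T) (hT : 40 ≤ δ * T)
    (hT' : 100 ≤ eta α Δ δ * T) (hst : s + T ≤ t) (hD : t - (s + T) ≤ (1 - g α Δ) * T) :
    P {ω | ¬ Race (H ω) Δ 0 Set.univ s T (max 0 (s - 1)) t}
      ≤ ENNReal.ofReal (5 * Real.exp (-(eta α Δ δ * T / 54))) := by
  have hlt : max 0 (s - 1) < t := max_lt (by linarith) (by linarith)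
  have hηα := eta_le hα hΔ hδ (by linarith)
  set γ := g α Δ with hγ
  have hγ0 : 0 < γ := Real.exp_pos _
  have hγ1 : γ < 1 := Real.exp_lt_one_iff.2 (by have := mul_pos hα hΔ; linarith)
  have hTγ : T ≤ T / γ := by
    rw [le_div_iff₀ hγ0]; nlinarith
  have hmean : β * (t - max 0 (s - 1)) ≤ (1 - 2 * δ) * (γ * (α * T)) := by
    -- Blocks with one long gap have rate `γ α` rather than `γ² α`, so the window counts as one of
    -- length `T / γ`. Since `(2 - γ) T ≤ T / γ`, this covers the extra adversarial time `(1 - γ)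
    -- T`.
    have h := mean_le_of_window (T := T / γ) (w' := 1) hα hγ0 hδ hδ' hαβ (sub_nonneg.2 hlt.le)
      zero_le_one ?_ ?_
    · refine h.trans (le_of_eq ?_)
      field_simp
    · have h1 := le_max_right 0 (s - 1)
      have h2 : (2 - γ) * T ≤ T / γ := by
        rw [le_div_iff₀ hγ0]
        nlinarith [mul_nonneg hT0.le (sq_nonneg (1 - γ))]
      linarith
    · rw [mul_one]
      exact hT.trans (by gcongr)
  refine (hH.race hα hβ 0 MeasurableSet.univ hγ0
    (fun i => prob_gap_univ hα (hH.law_gap 0) hΔ.le i) hδ (by linarith)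
    (by nlinarith) hs (le_max_left _ _) hlt hmean).trans (ENNReal.ofReal_le_ofReal ?_)
  have h1 : γ ^ 2 ≤ γ := by nlinarith
  have h2 : eta α Δ δ * T ≤ δ ^ 2 * (γ * (α * T)) := by
    calc eta α Δ δ * T = δ ^ 2 * (γ ^ 2 * (α * T)) := by rw [eta]; ring
      _ ≤ δ ^ 2 * (γ * (α * T)) := by gcongr
  gcongr

/-- The race between adversarial voter blocks and isolated honest ones. -/
lemma IsPrismSystem.voter_race (hα : 0 < α) (hβ : 0 ≤ β) (hΔ : 0 < Δ) {δ : ℝ} (hδ : 0 < δ)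
    (hδ' : δ < 40 / 81) (hαβ : β < (1 - 81 / 40 * δ) * g α Δ ^ 2 * α)
    (hH : IsPrismSystem P α β Δ H) (j : Fin (m + 1)) {s T : ℝ} (hs : 0 ≤ s) (hT0 : 0 < T)
    (hT : 40 * (Δ + 2) ≤ δ * T) (hT' : 100 ≤ eta α Δ δ * T) :
    P {ω | ¬ Race (H ω) Δ j (Set.Ioi Δ) s T (max 0 (s - 1)) (s + T + Δ + 1)}
      ≤ ENNReal.ofReal (5 * Real.exp (-(eta α Δ δ * T / 54))) := by
  have hlt : max 0 (s - 1) < s + T + Δ + 1 := max_lt (by linarith) (by linarith)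
  have hηα := eta_le hα hΔ hδ (by linarith)
  have hg0 : 0 < g α Δ := Real.exp_pos _
  have hmean := mean_le_of_window (T := T) (w' := Δ + 2) hα hg0 hδ hδ' hαβ (sub_nonneg.2 hlt.le)
    (by linarith)     (by linarith [le_max_right 0 (s - 1)]) hT
  have hi : iIndepFun (fun i ω => honestTime (H ω) j (i + 1) - honestTime (H ω) j i) P :=
    hH.indep_gap.precomp (g := fun i : ℕ => (j, i)) fun a b h => (Prod.mk.inj h).2
  refine (hH.race hα hβ j measurableSet_Ioi (pow_pos hg0 2)
    (fun i => prob_gap_pair hα hi (hH.law_gap j) hΔ.le i) hδ (by linarith)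
    (by nlinarith) hs (le_max_left _ _) hlt hmean).trans (le_of_eq ?_)
  rw [eta]
  congr 4; ring

/-- Permanence of transactions with a proposer window that ends at time `t - 2 * Δ - L`, followed by
voter windows of length `L + Δ`, and an explicit bound for the probability of failure. -/
theorem exists_event (hα : 0 < α) (hβ : 0 ≤ β) (hΔ : 0 < Δ) {δ : ℝ} (hδ : 0 < δ)
    (hδ' : δ < 40 / 81) (hαβ : β < (1 - 81 / 40 * δ) * g α Δ ^ 2 * α)
    (hH : IsPrismSystem P α β Δ H) (hm : 1 ≤ m) {Out : Type*} (spends : Tx → Set Out)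
    {r t L : ℝ} (hr : 0 ≤ r) (hL : 900 * (1 + Δ) ≤ δ * L) (hL' : 100 ≤ eta α Δ δ * L)
    (hT : L + 2 * Δ ≤ (1 - g α Δ) * (t - r - 3 * Δ - L)) :
    ∃ A : Set Ω, MeasurableSet A ∧
      1 - (m + 1) * (5 * Real.exp (-(eta α Δ δ * L / 54)) * (1 - Real.exp (-(eta α Δ δ / 54)))⁻¹ *
        (1 - Real.exp (-(eta α Δ δ / 54)))⁻¹) ≤ P.real A ∧
      ∀ ω ∈ A, ∀ tx : Tx, CredibleUntil spends (H ω) t tx →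
        (∃ x : Block m, tx ∈ (H ω).txs x ∧ (H ω).published x ≤ (r : WithTop ℝ)) →
        PermanentAfter spends (H ω) Δ t tx := by
  classical
  set γ := g α Δ with hγ
  set e := eta α Δ δ with he
  have hγ0 : 0 < γ := Real.exp_pos _
  have hγ1 : γ < 1 := (Real.exp_lt_one_iff).2 (by have := mul_pos hα hΔ; linarith)
  have he0 : 0 < e := by rw [he, eta]; positivity
  have hL0 : 0 < L := by
    by_contra h
    have : 0 < 900 * (1 + Δ) := by positivity
    nlinarith
  set T₀ := t - r - 3 * Δ - L with hT₀
  have hT₀0 : 0 < T₀ := by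
    by_contra h
    nlinarith [mul_nonneg (sub_nonneg.2 hγ1.le) (sub_nonneg.2 (not_lt.1 h))]
  have hT₀L : L ≤ T₀ := by nlinarith
  have hcells : ∀ T, L ≤ T → 900 * (1 + Δ) ≤ δ * T ∧ 100 ≤ e * T := fun T hLT =>
    ⟨hL.trans (by gcongr), hL'.trans (by gcongr)⟩
  set s₁ := r + Δ with hs₁
  set p₁ := t - 2 * Δ - L with hp₁
  set s₂ := p₁ + Δ with hs₂
  have hTs : T₀ = p₁ - s₁ := by rw [hT₀, hs₁, hp₁]; ring
  -- The integer `a` rounds how far before `s₁` or `s₂` a race starts, and `b` how far after `t` a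
  -- voter race ends. The adversary gets the extra unit in each rounding. Proposer races all end at
  -- `t`, whence `b = 0`.
  let Bad : Fin (m + 1) → ℕ → ℕ → Set Ω := fun j a b => {ω |
    if j = 0 then (a : ℝ) ≤ s₁ ∧ b = 0 ∧
      ¬ Race (H ω) Δ 0 Set.univ (s₁ - a) (T₀ + a) (max 0 (s₁ - a - 1)) t
    else (a : ℝ) ≤ s₂ ∧
      ¬ Race (H ω) Δ j (Set.Ioi Δ) (s₂ - a) (L + a + b) (max 0 (s₂ - a - 1)) (t + b + 1)}
  set q := Real.exp (-(e / 54)) with hq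
  have hq0 : 0 ≤ q := (Real.exp_pos _).le
  have hq1 : q < 1 := Real.exp_lt_one_iff.2 (by linarith)
  set K := 5 * Real.exp (-(e * L / 54)) with hK
  have hK0 : 0 ≤ K := by positivity
  have hKq : ∀ a b : ℕ, K * q ^ a * q ^ b = 5 * Real.exp (-(e * (L + a + b) / 54)) := by
    intro a b
    rw [hK, hq, ← Real.exp_nat_mul, ← Real.exp_nat_mul, mul_assoc, mul_assoc, ← Real.exp_add,
      ← Real.exp_add]
    congr 2; ring
  have hBad : ∀ j a b, P (Bad j a b) ≤ ENNReal.ofReal (K * q ^ a * q ^ b) := by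
    intro j a b
    have ha0 : (0 : ℝ) ≤ a := Nat.cast_nonneg a
    have hb0 : (0 : ℝ) ≤ b := Nat.cast_nonneg b
    rw [hKq]
    by_cases hj : j = 0
    · by_cases hab : (a : ℝ) ≤ s₁ ∧ b = 0
      · have hsub : Bad j a b ⊆
            {ω | ¬ Race (H ω) Δ 0 Set.univ (s₁ - a) (T₀ + a) (max 0 (s₁ - a - 1)) t} := by
          intro ω hω
          simp only [Bad, Set.mem_ofPred_eq, if_pos hj] at hω
          exact hω.2.2
        obtain ⟨h900, h100⟩ := hcells (T₀ + a) (by linarith)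
        refine (measure_mono hsub).trans ((hH.proposer_race hα hβ hΔ hδ hδ' hαβ
          (by linarith [hab.1]) (by linarith) (by linarith) h100 (by linarith) ?_).trans
          (ENNReal.ofReal_le_ofReal ?_))
        · have h2 : (1 - γ) * T₀ ≤ (1 - γ) * (T₀ + a) :=
            mul_le_mul_of_nonneg_left (by linarith) (by linarith)
          linarith
        · rw [hab.2, Nat.cast_zero, add_zero]
          gcongr
      · have : Bad j a b = ∅ := by
          ext ω
          simp only [Bad, Set.mem_ofPred_eq, if_pos hj, Set.mem_empty_iff_false, iff_false]
          exact fun h => hab ⟨h.1, h.2.1⟩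
        rw [this, measure_empty]; exact zero_le
    · by_cases hab : (a : ℝ) ≤ s₂
      · have hsub : Bad j a b ⊆ {ω | ¬ Race (H ω) Δ j (Set.Ioi Δ) (s₂ - a) (L + a + b)
            (max 0 (s₂ - a - 1)) ((s₂ - a) + (L + a + b) + Δ + 1)} := by
          intro ω hω
          simp only [Bad, Set.mem_ofPred_eq, if_neg hj] at hω
          rw [Set.mem_ofPred_eq, show (s₂ - a) + (L + a + b) + Δ + 1 = t + b + 1 by
            rw [hs₂, hp₁]; ring]
          exact hω.2
        obtain ⟨h900, h100⟩ := hcells (L + a + b) (by linarith)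
        exact (measure_mono hsub).trans (hH.voter_race hα hβ hΔ hδ hδ' hαβ j
          (by linarith) (by linarith) (by linarith) h100)
      · have : Bad j a b = ∅ := by
          ext ω
          simp only [Bad, Set.mem_ofPred_eq, if_neg hj, Set.mem_empty_iff_false, iff_false]
          exact fun h => hab h.1
        rw [this, measure_empty]; exact zero_le
  let W : Set Ω := (⋃ j, ⋃ a, ⋃ b, Bad j a b) ∪
    {ω | ¬ ∀ j i, 0 < honestTime (H ω) j (i + 1) - honestTime (H ω) j i}
  have hW : P W ≤ ENNReal.ofReal ((m + 1) * (K * (1 - q)⁻¹ * (1 - q)⁻¹)) := by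
    refine (measure_union_le _ _).trans ?_
    rw [ae_iff.1 (hH.ae_gap_pos hα), add_zero]
    exact measure_iUnion_geometric hK0 hq0 hq1 hBad
  -- `W` is not known to be measurable; a measurable hull has the same measure.
  refine ⟨(toMeasurable P W)ᶜ, (measurableSet_toMeasurable P W).compl, ?_, ?_⟩
  · rw [probReal_compl_eq_one_sub (measurableSet_toMeasurable P W)]
    refine sub_le_sub_left ?_ _
    rw [measureReal_def, measure_toMeasurable]
    have h1q : 0 ≤ (1 - q)⁻¹ := inv_nonneg.2 (by linarith)
    exact ENNReal.toReal_le_of_le_ofReal (by positivity) hW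
  · rintro ω hω tx htx ⟨x, hx, hxr⟩
    have hωW : ω ∉ W := fun h => hω (subset_toMeasurable P W h)
    simp only [W, Set.mem_union, Set.mem_iUnion, not_or, not_exists, Set.mem_ofPred_eq,
      not_not] at hωW
    obtain ⟨hgood, hpos⟩ := hωW
    have hF := hH.follows ω
    obtain ⟨b, hb, hsb, hbp, hbt⟩ := exists_uncontested hF (hpos 0) hΔ (s := s₁) (p := p₁) (t := t)
      (by linarith) (by
        intro s₀ hs0 hs0'
        have hfl := Nat.floor_le (sub_nonneg.2 hs0')
        have hlt := Nat.lt_floor_add_one (s₁ - s₀)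
        -- The grid window starts at `s₁ - a ≥ s₀` for honest blocks and no later than `s₀` for
        -- adversarial ones, so winning it wins the race from `s₀`.
        set a := ⌊s₁ - s₀⌋₊ with ha
        have hB := hgood 0 a 0
        simp only [Bad, Set.mem_ofPred_eq, if_true, true_and, not_and, not_not] at hB
        obtain ⟨F, hFl, hcard⟩ := hB (by linarith)
        refine ⟨F, fun l hl => ?_, lt_of_le_of_lt (hF.adversarialCount_mono ?_ le_rfl) hcard⟩
        · obtain ⟨h1, h2, h3, -⟩ := hFl l hl
          exact ⟨by linarith, by linarith, h3⟩
        · exact max_le hs0 (by linarith))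
    refine permanentAfter_of_uncontested hF hΔ hm (p := p₁) (by linarith) hb hsb hbp hbt ?_
      htx hx hxr
    intro i u hu c hc
    refine exists_honest_mem_chain hF (hpos i.succ) hΔ (by linarith) ?_ hu hc
    intro s₀ hs0 hs0' u₀ hu₀
    have hfl := Nat.floor_le (sub_nonneg.2 hs0')
    have hlt := Nat.lt_floor_add_one (s₂ - s₀)
    set a := ⌊s₂ - s₀⌋₊ with ha
    have hfl' := Nat.floor_le (sub_nonneg.2 hu₀)
    have hlt' := Nat.lt_floor_add_one (u₀ - t)
    set d := ⌊u₀ - t⌋₊ with hd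
    have hB := hgood i.succ a d
    simp only [Bad, Set.mem_ofPred_eq, if_neg (Fin.succ_ne_zero i), not_and, not_not] at hB
    obtain ⟨F, hFl, hcard⟩ := hB (by linarith)
    refine ⟨F, fun l hl => ?_, lt_of_le_of_lt (hF.adversarialCount_mono ?_ (by linarith)) hcard⟩
    · obtain ⟨h1, h2, h3, h4⟩ := hFl l hl
      exact ⟨by linarith, by linarith, h3, h4⟩
    · exact max_le hs0 (by linarith)

end System

/-! ### Comparison of the failure bound with `μ` and `ε` -/

section Numerics

variable {α Δ δ : ℝ}

lemma eta_pos (hα : 0 < α) (hδ : 0 < δ) : 0 < eta α Δ δ := by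
  have : 0 < g α Δ := Real.exp_pos _
  rw [eta]; positivity

/-- This is all that is needed of `μ`: it dominates `9 / (1 - exp (-η/27))²`. -/
lemma nine_le_mul_mu {η : ℝ} (hη : 0 < η) {M : ℝ}
    (hM : M = 9 * Real.exp (2 / 27 * η) / (1 - Real.exp (-(1 / 27 * η))) ^ 2) :
    9 ≤ (1 - Real.exp (-(1 / 27 * η))) ^ 2 * M := by
  have h1 : Real.exp (-(1 / 27 * η)) < 1 := Real.exp_lt_one_iff.2 (by linarith)
  have h2 : (1 - Real.exp (-(1 / 27 * η))) ^ 2 ≠ 0 := pow_ne_zero _ (by linarith)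
  rw [hM, mul_div_cancel₀ _ h2]
  have := Real.one_le_exp (show 0 ≤ 2 / 27 * η by linarith)
  linarith

lemma nine_le_mu (hα : 0 < α) (hδ : 0 < δ) : 9 ≤ mu α Δ δ := by
  have h := nine_le_mul_mu (eta_pos (Δ := Δ) hα hδ) (M := mu α Δ δ) rfl
  have h1 : Real.exp (-(1 / 27 * eta α Δ δ)) < 1 :=
    Real.exp_lt_one_iff.2 (by have := eta_pos (Δ := Δ) hα hδ; linarith)
  have h2 := Real.exp_pos (-(1 / 27 * eta α Δ δ))
  have h3 : (1 - Real.exp (-(1 / 27 * eta α Δ δ))) ^ 2 ≤ 1 :=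
    pow_le_one₀ (by linarith) (by linarith)
  by_contra hlt
  have h4 : 0 < mu α Δ δ := by
    by_contra h5
    nlinarith [mul_nonneg (sq_nonneg (1 - Real.exp (-(1 / 27 * eta α Δ δ))))
      (sub_nonneg.2 (not_lt.1 h5))]
  nlinarith

/-- With `q = exp (-η/54)`, the base in `μ` is `1 - q² = (1 + q)(1 - q) ≤ 2 (1 - q)`, which costs a
factor 4. -/
lemma inv_sq_le_mu (hα : 0 < α) (hδ : 0 < δ) :
    (1 - Real.exp (-(eta α Δ δ / 54)))⁻¹ * (1 - Real.exp (-(eta α Δ δ / 54)))⁻¹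
      ≤ 4 / 9 * mu α Δ δ := by
  have hη := eta_pos (Δ := Δ) hα hδ
  have h := nine_le_mul_mu hη (M := mu α Δ δ) rfl
  have hμ := nine_le_mu (Δ := Δ) hα hδ
  set q := Real.exp (-(eta α Δ δ / 54)) with hq
  have hq0 : 0 < q := Real.exp_pos _
  have hq1 : q < 1 := Real.exp_lt_one_iff.2 (by linarith)
  have hqq : Real.exp (-(1 / 27 * eta α Δ δ)) = q ^ 2 := by
    rw [hq, ← Real.exp_nat_mul]; congr 1; push_cast; ring
  rw [hqq] at h
  rw [← mul_inv, inv_le_iff_one_le_mul₀ (by nlinarith)]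
  have h1 : (1 - q ^ 2) ^ 2 ≤ 4 * ((1 - q) * (1 - q)) := by
    have : (1 - q ^ 2) ^ 2 = (1 + q) ^ 2 * ((1 - q) * (1 - q)) := by ring
    rw [this]
    have h2 : (1 + q) ^ 2 ≤ 4 := by nlinarith
    exact mul_le_mul_of_nonneg_right h2 (mul_self_nonneg _)
  nlinarith [mul_le_mul_of_nonneg_right h1 (by linarith : 0 ≤ mu α Δ δ)]

/-- The failure probability for windows of length `300 log (N / ε) / η`. -/
lemma failure_le (hα : 0 < α) (hδ : 0 < δ) {n ε L : ℝ} (hn : 1 ≤ n) (hε : 0 < ε) (hε1 : ε < 1)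
    (hL : eta α Δ δ * L = 300 * Real.log (n * mu α Δ δ / ε)) :
    n * (5 * Real.exp (-(eta α Δ δ * L / 54)) * (1 - Real.exp (-(eta α Δ δ / 54)))⁻¹ *
        (1 - Real.exp (-(eta α Δ δ / 54)))⁻¹) ≤ ε := by
  have hμ := nine_le_mu (Δ := Δ) hα hδ
  have hinv := inv_sq_le_mu (Δ := Δ) hα hδ
  set M := mu α Δ δ with hM
  have hnM : 9 ≤ n * M := by nlinarith
  have hN0 : 0 < n * M / ε := by positivity
  have hN1 : 1 ≤ n * M / ε := by rw [le_div_iff₀ hε]; linarith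
  have hlog : 0 ≤ Real.log (n * M / ε) := Real.log_nonneg hN1
  set w := ε / (n * M) with hw
  have hw0 : 0 < w := by positivity
  have hw9 : w ≤ 1 / 9 := by
    rw [hw, div_le_iff₀ (by linarith)]; linarith
  -- Since `300 / 54 > 5`, five powers of `w` are available: one produces `ε`, the other four
  -- outweigh the constant `20/9`.
  have hexp : Real.exp (-(eta α Δ δ * L / 54)) ≤ w ^ 5 := by
    have h1 : w = Real.exp (-Real.log (n * M / ε)) := by
      rw [Real.exp_neg, Real.exp_log hN0, inv_div]
    rw [h1, ← Real.exp_nat_mul, hL]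
    refine Real.exp_le_exp.2 ?_
    push_cast
    linarith
  have hwε : n * M * w = ε := by rw [hw]; field_simp
  calc n * (5 * Real.exp (-(eta α Δ δ * L / 54)) * (1 - Real.exp (-(eta α Δ δ / 54)))⁻¹ *
        (1 - Real.exp (-(eta α Δ δ / 54)))⁻¹)
      = 5 * n * Real.exp (-(eta α Δ δ * L / 54)) * ((1 - Real.exp (-(eta α Δ δ / 54)))⁻¹ *
        (1 - Real.exp (-(eta α Δ δ / 54)))⁻¹) := by ring
    _ ≤ 5 * n * w ^ 5 * (4 / 9 * M) := by
        gcongr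
        exact mul_self_nonneg _
    _ = 20 / 9 * w ^ 4 * (n * M * w) := by ring
    _ = 20 / 9 * w ^ 4 * ε := by rw [hwε]
    _ ≤ 1 * ε := by
        gcongr
        have : w ^ 4 ≤ (1 / 9) ^ 4 := by gcongr
        linarith
    _ = ε := one_mul ε

end Numerics

end Prism

/-! ### The choice of window lengths -/

theorem mainTheorem11 {Ω : Type*} [MeasurableSpace Ω] (P : Measure Ω) [IsProbabilityMeasure P]
    {Tx Out : Type*} (spends : Tx → Set Out) (m : ℕ) (hm : 1 ≤ m)
    (α β Δ δ : ℝ) (hα : 1 / 2 < α) (hβ : 0 ≤ β) (hΔ : 0 < Δ) (hδ : 0 < δ) (hδ' : δ < 40 / 81)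
    (hαβ : β < (1 - 81 / 40 * δ) * Prism.g α Δ ^ 2 * α)
    (H : Ω → Prism.History m Tx) (hH : Prism.IsPrismSystem P α β Δ H)
    (ε : ℝ) (hε : 0 < ε)
    (hε' : ε < (m + 1) * Prism.mu α Δ δ * Real.exp (-(3 * (1 + Δ) * δ * Prism.g α Δ ^ 2 * α)))
    (k : ℤ)
    (hk : k = ⌈54 * α / Prism.eta α Δ δ * Real.log ((m + 1) * Prism.mu α Δ δ / ε) + 4 * α * Δ⌉)
    (r t : ℝ)
    (ht : t = r + 2 * (k + 1) /
      ((1 - 41 / 40 * δ) ^ 2 * (1 - Prism.g α Δ) ^ 2 * Prism.g α Δ ^ 2 * α) + Δ) :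
    ∃ A : Set Ω, MeasurableSet A ∧ 1 - ε ≤ P.real A ∧
      ∀ ω ∈ A, ∀ tx : Tx, Prism.CredibleUntil spends (H ω) t tx →
        (∃ x : Prism.Block m, tx ∈ (H ω).txs x ∧ (H ω).published x ≤ (r : WithTop ℝ)) →
        Prism.PermanentAfter spends (H ω) Δ t tx := by
  rcases le_or_gt 1 ε with hε1 | hε1
  · exact ⟨∅, MeasurableSet.empty, by simpa using hε1, fun ω h => absurd h (Set.notMem_empty ω)⟩
  rcases lt_or_ge r 0 with hr | hr
  · refine ⟨Set.univ, MeasurableSet.univ, by simpa using hε.le, ?_⟩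
    rintro ω - tx - ⟨x, -, hx⟩
    have h1 := (hH.follows ω).mined_nonneg x
    have h2 := WithTop.coe_le_coe.1 (((hH.follows ω).mined_le_published x).trans hx)
    linarith
  have hα0 : 0 < α := by linarith
  have hη := Prism.eta_pos (Δ := Δ) hα0 hδ
  have hμ := Prism.nine_le_mu (Δ := Δ) hα0 hδ
  have hm1 : (1 : ℝ) ≤ m + 1 := by
    have : (0 : ℝ) ≤ m := Nat.cast_nonneg m
    linarith
  set η := Prism.eta α Δ δ with hηdef
  set M := Prism.mu α Δ δ with hM
  set γ := Prism.g α Δ with hγ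
  have hγ0 : 0 < γ := Real.exp_pos _
  have hγ1 : γ < 1 := Real.exp_lt_one_iff.2 (by have := mul_pos hα0 hΔ; linarith)
  set ℓ := Real.log ((m + 1) * M / ε) with hℓ
  have hN : 0 < (m + 1) * M / ε := by positivity
  have hℓ1 : 1 ≤ ℓ := by
    rw [hℓ, Real.le_log_iff_exp_le hN, le_div_iff₀ hε]
    have := Real.exp_one_lt_d9
    nlinarith [Real.exp_pos 1]
  have hℓ2 : 3 * (1 + Δ) * δ * γ ^ 2 * α ≤ ℓ := by
    rw [hℓ, Real.le_log_iff_exp_le hN, le_div_iff₀ hε]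
    rw [Real.exp_neg, ← div_eq_mul_inv, lt_div_iff₀ (Real.exp_pos _)] at hε'
    linarith
  set Λ := ℓ / η with hΛ
  have hηΛ : η * Λ = ℓ := by rw [hΛ]; field_simp
  have hΛ0 : 0 < Λ := by rw [hΛ]; positivity
  -- The upper bound on `ε` enters here; multiplied by 300 it is the requirement on `δ * L`.
  have hδΛ : 3 * (1 + Δ) ≤ δ * Λ := by
    have h1 : η = δ * (δ * γ ^ 2 * α) := by rw [hηdef, Prism.eta]; ring
    have h2 : 0 < δ * γ ^ 2 * α := by positivity
    rw [h1] at hηΛ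
    have h3 : (δ * γ ^ 2 * α) * (3 * (1 + Δ)) ≤ (δ * γ ^ 2 * α) * (δ * Λ) := by linarith
    exact le_of_mul_le_mul_left h3 h2
  have hkΛ : α * (54 * Λ + 4 * Δ) ≤ k := by
    rw [hk]
    refine le_trans (le_of_eq ?_) (Int.le_ceil _)
    rw [hΛ]; field_simp
  -- the length of the waiting time
  have hd : 0 < 1 - 41 / 40 * δ := by linarith
  have hwait : 729 * Λ + 54 * Δ ≤ (1 - γ) * (t - r - Δ) := by
    have h1 : t - r - Δ = 2 * (k + 1) / ((1 - 41 / 40 * δ) ^ 2 * (1 - γ) ^ 2 * γ ^ 2 * α) := by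
      rw [ht]; ring
    have h1γ : 0 < 1 - γ := by linarith
    have h2 : (1 - γ) * (2 * (k + 1) / ((1 - 41 / 40 * δ) ^ 2 * (1 - γ) ^ 2 * γ ^ 2 * α))
        = 2 * (k + 1) / ((1 - 41 / 40 * δ) ^ 2 * ((1 - γ) * γ ^ 2) * α) := by
      field_simp
    rw [h1, h2, le_div_iff₀ (by positivity)]
    -- The maximum is at `γ = 2/3`; the product `(γ - 2/3)² (γ + 1/3)` is exactly the difference.
    have h3 : (1 - γ) * γ ^ 2 ≤ 4 / 27 := by
      nlinarith [mul_nonneg (sq_nonneg (γ - 2 / 3)) (by linarith : 0 ≤ γ + 1 / 3)]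
    have h4 : (1 - 41 / 40 * δ) ^ 2 ≤ 1 := pow_le_one₀ hd.le (by linarith)
    calc (729 * Λ + 54 * Δ) * ((1 - 41 / 40 * δ) ^ 2 * ((1 - γ) * γ ^ 2) * α)
        ≤ (729 * Λ + 54 * Δ) * (1 * (4 / 27) * α) := by gcongr
      _ = 2 * (α * (54 * Λ + 4 * Δ)) := by ring
      _ ≤ 2 * (k + 1) := by linarith
  obtain ⟨A, hA, hPA, hAω⟩ := Prism.exists_event hα0 hβ hΔ hδ hδ' hαβ hH hm spends
    (r := r) (t := t) (L := 300 * Λ) hr (by linarith) (by rw [← hηdef]; linarith) (by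
      rw [← hγ]
      nlinarith [mul_pos hγ0 hΛ0, mul_pos hγ0 hΔ])
  refine ⟨A, hA, le_trans ?_ hPA, hAω⟩
  refine sub_le_sub_left (Prism.failure_le hα0 hδ hm1 hε hε1 ?_) _
  rw [← hηdef, ← hM, ← hℓ, ← hηΛ]; ring
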